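/- Let $K$ be a field of characteristic zero. A *monoid scheme* over $K$ is a monoid object in the category of $K$-schemes; it is called an *algebraic monoid* over $K$ if the underlying $K$-scheme is integral, separated and of finite type. For a field extension $L/K$ and a monoid scheme $M$ over $K$ let $M\otimes_K L$ be its base change, and let $\mathrm{Aut}(M)(L)$ be the group of automorphisms of the monoid scheme $M\otimes_K L$ over $L$. An algebraic monoid $M'$ over $K$ is a *twisted form* of $M$ if $M'\otimes_K L\cong M\otimes_K L$ as monoid schemes over $L$ for some finite Galois extension $L/K$; it is *trivial* if $M'\cong M$ over $K$. For a finite Galois extension $L/K$ with group $\Gamma$, acting on $\mathrm{Aut}(M)(L)$ by conjugation with its action on $M\otimes_K L$ through $L$, let $H^1(\Gamma,\mathrm{Aut}(M)(L))$ be the pointed set of maps $f\colon\Gamma\to\mathrm{Aut}(M)(L)$ with $f(\tau\rho)=f(\tau)\cdot\tau f(\rho)$, modulo $f\sim g$ if $g(\sigma)=a f(\sigma)\,\sigma(a)^{-1}$ for some $a\in \mathrm{Aut}(M)(L)$ and all $\sigma\in\Gamma$. Let $H^1(\mathrm{Gal}_{\overline K/K},\mathrm{Aut}(M))$ be the direct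 limit of these sets over all finite Galois extensions $L$ of $K$ inside $\overline K$. Let $b,c$ be integers with $0<b\le c$, and write $c=bd+e$ with integers $d,e$ and $0\le e<b$. Let $$Q_{b,c}(x_1,y_1,x_2,y_2)=\frac{(x_1^by_2+y_1^bx_2)^{d+1}-(x_1^by_2)^{d+1}-(y_1^bx_2)^{d+1}}{x_1^{b-e}y_1^{b-e}},$$ which is a polynomial, and let $M$ be the commutative algebraic monoid $\mathbb A^3_K$ with the product $$(x_1,x_2,x_3)*(y_1,y_2,y_3)=(x_1y_1,\;x_1^by_2+y_1^bx_2,\;x_1^cy_3+y_1^cx_3+Q_{b,c}(x_1,y_1,x_2,y_2))$$ and the unit $(1,0,0)$. Then: 1. $M$ has no nontrivial twisted forms. 2. For every field extension $L/K$, sending the matrix $\left(\begin{smallmatrix}\alpha&0\\ \gamma&\alpha^{d+1}\end{smallmatrix}\right)$ to the map $$(x_1,x_2,x_3)\mapsto(x_1,\;\alpha x_2,\;\gamma x_1^{c-b}x_2+\alpha^{d+1}x_3)$$ is an isomorphism from the group of all matrices $\left(\begin{smallmatrix}\alpha&0\\ \gamma&\alpha^{d+1}\end{smallmatrix}\right)\in\mathrm{GL}_2(L)$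 onto $\mathrm{Aut}(M)(L)$. 3. This matrix group is a semidirect product $\mathbb G_a\rtimes\mathbb G_m$: for every $L$, the map $(\gamma,\alpha)\mapsto\left(\begin{smallmatrix}\alpha&0\\ \gamma\alpha&\alpha^{d+1}\end{smallmatrix}\right)$ is an isomorphism onto it from $L\rtimes L^\times$, where $\alpha\in L^\times$ acts on the additive group of $L$ by $\gamma\mapsto\alpha^d\gamma$. 4. $H^1(\mathrm{Gal}_{L/K},\mathrm{Aut}(M)(L))$ consists of the base point alone for every finite Galois extension $L/K$, and so does $H^1(\mathrm{Gal}_{\overline K/K},\mathrm{Aut}(M))$. -/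

import Mathlib

open MvPolynomial TensorProduct
universe u

noncomputable section
namespace SplitMonoid

variable (K : Type u) [Field K] (b c : ℕ)

/-- The numerator `(x₁ᵇ y₂ + y₁ᵇ x₂)^(d+1) - (x₁ᵇ y₂)^(d+1) - (y₁ᵇ x₂)^(d+1)` of `Q_{b,c}`,
where `d = c / b`. The variables `x₁, x₂, x₃` are `X (inl 0), X (inl 1), X (inl 2)` and
`y₁, y₂, y₃` are `X (inr 0), X (inr 1), X (inr 2)`. -/
def numQ : MvPolynomial (Fin 3 ⊕ Fin 3) K :=
  (X (.inl 0) ^ b * X (.inr 1) + X (.inr 0) ^ b * X (.inl 1)) ^ (c / b + 1)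
    - (X (.inl 0) ^ b * X (.inr 1)) ^ (c / b + 1)
    - (X (.inr 0) ^ b * X (.inl 1)) ^ (c / b + 1)

/-- The exponent vector of the denominator `x₁^(b-e) y₁^(b-e)` of `Q_{b,c}`, where `e = c % b`. -/
def denomExp : (Fin 3 ⊕ Fin 3) →₀ ℕ :=
  Finsupp.single (.inl 0) (b - c % b) + Finsupp.single (.inr 0) (b - c % b)

/-- The polynomial `Q_{b,c}`. The division is exact, see `denom_mul_Q`. -/
def Q : MvPolynomial (Fin 3 ⊕ Fin 3) K :=
  (numQ K b c).divMonomial (denomExp b c)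

theorem mul_dvd_add_pow_sub {R : Type*} [CommRing R] (s t : R) (n : ℕ) :
    s * t ∣ (s + t) ^ (n + 1) - s ^ (n + 1) - t ^ (n + 1) := by
  induction n with
  | zero => simp
  | succ n ih =>
    obtain ⟨r, hr⟩ := ih
    refine ⟨(s + t) * r + t ^ n + s ^ n, ?_⟩
    linear_combination (s + t) * hr

theorem denom_dvd_num {R : Type*} [CommRing R] (s t p q : R) {m n : ℕ} (h : m ≤ n) (k : ℕ) :
    (s * t) ^ m ∣ (s ^ n * p + t ^ n * q) ^ (k + 1) - (s ^ n * p) ^ (k + 1)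
      - (t ^ n * q) ^ (k + 1) := by
  refine (pow_dvd_pow (s * t) h).trans (Dvd.dvd.trans ?_ (mul_dvd_add_pow_sub _ _ k))
  exact ⟨p * q, by ring⟩

theorem denom_mul_Q :
    (X (.inl 0) * X (.inr 0)) ^ (b - c % b) * Q K b c = numQ K b c := by
  have hm : (monomial (denomExp b c) (1 : K)) =
      (X (.inl 0) * X (.inr 0)) ^ (b - c % b) := by
    rw [denomExp, mul_pow, X_pow_eq_monomial, X_pow_eq_monomial, monomial_mul, one_mul]
  have hd : monomial (denomExp b c) (1 : K) ∣ numQ K b c := by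
    rw [hm]
    exact denom_dvd_num _ _ _ _ (Nat.sub_le b (c % b)) (c / b)
  obtain ⟨p, hp⟩ := hd
  rw [Q, hp, divMonomial_monomial_mul, hm]

/-- The three components of the product `(x₁, x₂, x₃) * (y₁, y₂, y₃)`. -/
def mulPoly : Fin 3 → MvPolynomial (Fin 3 ⊕ Fin 3) K :=
  ![X (.inl 0) * X (.inr 0),
    X (.inl 0) ^ b * X (.inr 1) + X (.inr 0) ^ b * X (.inl 1),
    X (.inl 0) ^ c * X (.inr 2) + X (.inr 0) ^ c * X (.inl 2) + Q K b c]

section points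

variable {K}
variable {B : Type*} [CommRing B] [Algebra K B]

/-- The product on the `B`-points `B³`, for a commutative `K`-algebra `B`. -/
def mulPt (x y : Fin 3 → B) : Fin 3 → B :=
  fun i => aeval (Sum.elim x y) (mulPoly K b c i)

/-- The unit `(1, 0, 0)`. -/
def onePt : Fin 3 → B := ![1, 0, 0]

theorem map_mulPt {B' : Type*} [CommRing B'] [Algebra K B'] (h : B →ₐ[K] B') (x y : Fin 3 → B)
    (i : Fin 3) : h (mulPt (K := K) b c x y i)
      = mulPt (K := K) b c (fun j => h (x j)) (fun j => h (y j)) i := by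
  rw [mulPt, mulPt, ← AlgHom.comp_apply, comp_aeval]
  congr 2
  funext j
  rcases j with j | j <;> rfl

/-- The value of `Q_{b,c}` at a pair of points. -/
def QPt (x y : Fin 3 → B) : B := aeval (Sum.elim x y) (Q K b c)

theorem mulPt_zero (x y : Fin 3 → B) : mulPt (K := K) b c x y 0 = x 0 * y 0 := by
  simp [mulPt, mulPoly]
theorem mulPt_one (x y : Fin 3 → B) :
    mulPt (K := K) b c x y 1 = x 0 ^ b * y 1 + y 0 ^ b * x 1 := by
  simp [mulPt, mulPoly]
theorem mulPt_two (x y : Fin 3 → B) :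
    mulPt (K := K) b c x y 2 = x 0 ^ c * y 2 + y 0 ^ c * x 2 + QPt (K := K) b c x y := by
  simp [mulPt, mulPoly, QPt]

theorem denom_mul_QPt (x y : Fin 3 → B) :
    (x 0 * y 0) ^ (b - c % b) * QPt (K := K) b c x y =
      (x 0 ^ b * y 1 + y 0 ^ b * x 1) ^ (c / b + 1) - (x 0 ^ b * y 1) ^ (c / b + 1)
        - (y 0 ^ b * x 1) ^ (c / b + 1) := by
  have := congrArg (aeval (Sum.elim x y)) (denom_mul_Q K b c)
  simpa [numQ, QPt] using this


theorem pow_denom (hb : 0 < b) (t : B) :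
    t ^ c * t ^ (b - c % b) = (t ^ b) ^ (c / b + 1) := by
  rw [← pow_add, ← pow_mul]
  congr 1
  have h1 := Nat.div_add_mod c b
  have h2 := Nat.mod_lt c hb
  rw [mul_add]
  omega

theorem QPt_cocycle [IsDomain B] (x y z : Fin 3 → B) (hx : x 0 ≠ 0) (hy : y 0 ≠ 0)
    (hz : z 0 ≠ 0) :
    z 0 ^ c * QPt (K := K) b c x y + QPt (K := K) b c (mulPt (K := K) b c x y) z =
      x 0 ^ c * QPt (K := K) b c y z + QPt (K := K) b c x (mulPt (K := K) b c y z) := by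
  have e1 := denom_mul_QPt (K := K) b c x y
  have e2 := denom_mul_QPt (K := K) b c y z
  have e3 := denom_mul_QPt (K := K) b c (mulPt (K := K) b c x y) z
  have e4 := denom_mul_QPt (K := K) b c x (mulPt (K := K) b c y z)
  rw [mulPt_zero, mulPt_one] at e3 e4
  rcases Nat.eq_zero_or_pos b with rfl | hb
  · simp at e1 e2 e3 e4
    rw [e1, e2, e3, e4]; simp
  have px := pow_denom b c hb (x 0)
  have pz := pow_denom b c hb (z 0)
  have hne : (x 0 * y 0 * z 0) ^ (b - c % b) ≠ 0 :=
    pow_ne_zero _ (mul_ne_zero (mul_ne_zero hx hy) hz)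
  apply mul_left_cancel₀ hne
  generalize b - c % b = P at *
  generalize c / b + 1 = D at *
  generalize QPt (K := K) b c x y = q1 at *
  generalize QPt (K := K) b c y z = q2 at *
  generalize QPt (K := K) b c (mulPt (K := K) b c x y) z = q3 at *
  generalize QPt (K := K) b c x (mulPt (K := K) b c y z) = q4 at *
  have e1' : (z 0 ^ c * z 0 ^ P) * ((x 0 * y 0) ^ P * q1) =
      (z 0 ^ b * (x 0 ^ b * y 1 + y 0 ^ b * x 1)) ^ D - (z 0 ^ b * (x 0 ^ b * y 1)) ^ D
        - (z 0 ^ b * (y 0 ^ b * x 1)) ^ D := by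
    rw [pz, e1]; simp only [mul_sub, mul_pow]
  have e2' : (x 0 ^ c * x 0 ^ P) * ((y 0 * z 0) ^ P * q2) =
      (x 0 ^ b * (y 0 ^ b * z 1 + z 0 ^ b * y 1)) ^ D - (x 0 ^ b * (y 0 ^ b * z 1)) ^ D
        - (x 0 ^ b * (z 0 ^ b * y 1)) ^ D := by
    rw [px, e2]; simp only [mul_sub, mul_pow]
  have r1 : (x 0 * y 0) ^ b * z 1 + z 0 ^ b * (x 0 ^ b * y 1 + y 0 ^ b * x 1) =
      x 0 ^ b * (y 0 ^ b * z 1 + z 0 ^ b * y 1) + (y 0 * z 0) ^ b * x 1 := by ring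
  have r2 : (x 0 * y 0) ^ b * z 1 = x 0 ^ b * (y 0 ^ b * z 1) := by ring
  have r3 : (y 0 * z 0) ^ b * x 1 = z 0 ^ b * (y 0 ^ b * x 1) := by ring
  have r4 : z 0 ^ b * (x 0 ^ b * y 1) = x 0 ^ b * (z 0 ^ b * y 1) := by ring
  rw [r1, r2, r3] at e3
  rw [r3] at e4
  rw [r4] at e1'
  simp only [mul_pow (x 0 * y 0) (z 0), mul_pow (x 0) (y 0), mul_pow (y 0) (z 0),
    mul_pow (x 0) (y 0 * z 0)] at *
  linear_combination e1' + e3 - e2' - e4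

theorem mulPt_assoc_of_ne [IsDomain B] (x y z : Fin 3 → B) (hx : x 0 ≠ 0) (hy : y 0 ≠ 0)
    (hz : z 0 ≠ 0) :
    mulPt (K := K) b c (mulPt (K := K) b c x y) z =
      mulPt (K := K) b c x (mulPt (K := K) b c y z) := by
  funext i
  fin_cases i
  · simp only [Fin.zero_eta, mulPt_zero]; ring
  · simp only [Fin.mk_one, mulPt_zero, mulPt_one]; ring
  · have := QPt_cocycle (K := K) b c x y z hx hy hz
    simp only [Fin.reduceFinMk, mulPt_zero, mulPt_two]
    linear_combination this

/-- Associativity of the product on points. -/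
theorem mulPt_assoc (x y z : Fin 3 → B) :
    mulPt (K := K) b c (mulPt (K := K) b c x y) z =
      mulPt (K := K) b c x (mulPt (K := K) b c y z) := by
  let g : Fin 3 → Fin 3 → MvPolynomial (Fin 3 × Fin 3) K := fun k i => X (k, i)
  let h : MvPolynomial (Fin 3 × Fin 3) K →ₐ[K] B := aeval fun p => ![x, y, z] p.1 p.2
  have key := mulPt_assoc_of_ne (K := K) b c (g 0) (g 1) (g 2)
    (X_ne_zero _) (X_ne_zero _) (X_ne_zero _)
  have h0 : (fun j => h (g 0 j)) = x := by funext j; simp [h, g]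
  have h1 : (fun j => h (g 1 j)) = y := by funext j; simp [h, g]
  have h2 : (fun j => h (g 2 j)) = z := by funext j; simp [h, g]
  funext i
  have := congrArg h (congrFun key i)
  simp only [map_mulPt, h0, h1, h2] at this
  exact this

theorem QPt_comm_of_ne [IsDomain B] (x y : Fin 3 → B) (hx : x 0 ≠ 0) (hy : y 0 ≠ 0) :
    QPt (K := K) b c x y = QPt (K := K) b c y x := by
  have e1 := denom_mul_QPt (K := K) b c x y
  have e2 := denom_mul_QPt (K := K) b c y x
  apply mul_left_cancel₀ (pow_ne_zero (b - c % b) (mul_ne_zero hx hy))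
  rw [e1, mul_comm (x 0) (y 0), e2, add_comm]
  ring

theorem QPt_one_of_ne [IsDomain B] (x : Fin 3 → B) (hx : x 0 ≠ 0) :
    QPt (K := K) b c x onePt = 0 := by
  have e1 := denom_mul_QPt (K := K) b c x onePt
  apply mul_left_cancel₀ (pow_ne_zero (b - c % b) hx)
  simpa [onePt] using e1

theorem map_QPt {B' : Type*} [CommRing B'] [Algebra K B'] (h : B →ₐ[K] B') (x y : Fin 3 → B) :
    h (QPt (K := K) b c x y)
      = QPt (K := K) b c (fun j => h (x j)) (fun j => h (y j)) := by
  rw [QPt, QPt, ← AlgHom.comp_apply, comp_aeval]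
  congr 2
  funext j
  rcases j with j | j <;> rfl

theorem QPt_comm (x y : Fin 3 → B) : QPt (K := K) b c x y = QPt (K := K) b c y x := by
  let g : Fin 2 → Fin 3 → MvPolynomial (Fin 2 × Fin 3) K := fun k i => X (k, i)
  let h : MvPolynomial (Fin 2 × Fin 3) K →ₐ[K] B := aeval fun p => ![x, y] p.1 p.2
  have key := congrArg h (QPt_comm_of_ne (K := K) b c (g 0) (g 1) (X_ne_zero _) (X_ne_zero _))
  have h0 : (fun j => h (g 0 j)) = x := by funext j; simp [h, g]
  have h1 : (fun j => h (g 1 j)) = y := by funext j; simp [h, g]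
  simpa only [map_QPt, h0, h1] using key

theorem QPt_one (x : Fin 3 → B) : QPt (K := K) b c x onePt = 0 := by
  let g : Fin 3 → MvPolynomial (Fin 3) K := X
  let h : MvPolynomial (Fin 3) K →ₐ[K] B := aeval x
  have key := congrArg h (QPt_one_of_ne (K := K) b c g (X_ne_zero _))
  have h0 : (fun j => h (g j)) = x := by funext j; simp [h, g]
  have h1 : (fun j => h ((onePt : Fin 3 → MvPolynomial (Fin 3) K) j)) = onePt := by
    funext j; fin_cases j <;> simp [onePt]
  simpa only [map_QPt, h0, h1, map_zero] using key

/-- Commutativity of the product on points. -/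
theorem mulPt_comm (x y : Fin 3 → B) :
    mulPt (K := K) b c x y = mulPt (K := K) b c y x := by
  funext i
  fin_cases i
  · simp only [Fin.zero_eta, mulPt_zero]; ring
  · simp only [Fin.mk_one, mulPt_one]; ring
  · simp only [Fin.reduceFinMk, mulPt_two, QPt_comm b c x y]; ring

/-- `(1, 0, 0)` is a unit for the product on points. -/
theorem mulPt_onePt (x : Fin 3 → B) : mulPt (K := K) b c x onePt = x := by
  funext i
  fin_cases i
  · simp [mulPt_zero, onePt]
  · simp [mulPt_one, onePt]
  · simp only [Fin.reduceFinMk, mulPt_two, QPt_one]; simp [onePt]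

end points

/-- The coordinate ring `K[x₁, x₂, x₃]` of `𝔸³`, with the bialgebra structure given by the monoid
structure with parameters `b` and `c`. -/
def CoordRing (K : Type u) [Field K] (_b _c : ℕ) : Type u := MvPolynomial (Fin 3) K

variable (K : Type u) [Field K] (b c : ℕ)

instance : CommRing (CoordRing K b c) := inferInstanceAs (CommRing (MvPolynomial (Fin 3) K))
instance : Algebra K (CoordRing K b c) := inferInstanceAs (Algebra K (MvPolynomial (Fin 3) K))

/-- The coordinate functions `x₁, x₂, x₃` on `𝔸³`. -/
def coord (i : Fin 3) : CoordRing K b c := (X i : MvPolynomial (Fin 3) K)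

/-- The algebra homomorphism out of `K[x₁, x₂, x₃]` with prescribed values on the coordinates. -/
def evalPt {B : Type*} [CommRing B] [Algebra K B] (x : Fin 3 → B) : CoordRing K b c →ₐ[K] B :=
  (aeval x : MvPolynomial (Fin 3) K →ₐ[K] B)

variable {K b c} in
@[simp] theorem evalPt_coord {B : Type*} [CommRing B] [Algebra K B] (x : Fin 3 → B) (i : Fin 3) :
    evalPt K b c x (coord K b c i) = x i :=
  aeval_X (R := K) x i

variable {K b c} in
theorem coordRing_hom_ext {B : Type*} [CommRing B] [Algebra K B] {f g : CoordRing K b c →ₐ[K] B}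
    (h : ∀ i, f (coord K b c i) = g (coord K b c i)) : f = g :=
  MvPolynomial.algHom_ext (R := K) (σ := Fin 3) h

/-- The comultiplication: the coordinates of the product of the two points
`(xᵢ ⊗ 1)ᵢ` and `(1 ⊗ xᵢ)ᵢ`. -/
def comulHom : CoordRing K b c →ₐ[K] CoordRing K b c ⊗[K] CoordRing K b c :=
  evalPt K b c (mulPt (K := K) b c (fun i => coord K b c i ⊗ₜ[K] 1)
    (fun i => 1 ⊗ₜ[K] coord K b c i))

/-- The counit: evaluation at the unit `(1, 0, 0)`. -/
def counitHom : CoordRing K b c →ₐ[K] K := evalPt K b c onePt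


theorem comulHom_coassoc :
    (Algebra.TensorProduct.assoc K K K (CoordRing K b c) (CoordRing K b c)
      (CoordRing K b c)).toAlgHom.comp
        ((Algebra.TensorProduct.map (comulHom K b c) (.id K _)).comp (comulHom K b c)) =
      (Algebra.TensorProduct.map (.id K _) (comulHom K b c)).comp (comulHom K b c) := by
  set A := CoordRing K b c
  let x : Fin 3 → A := coord K b c
  let p : Fin 3 → A ⊗[K] (A ⊗[K] A) := fun i => x i ⊗ₜ[K] (1 ⊗ₜ[K] 1)
  let q : Fin 3 → A ⊗[K] (A ⊗[K] A) := fun i => 1 ⊗ₜ[K] (x i ⊗ₜ[K] 1)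
  let r : Fin 3 → A ⊗[K] (A ⊗[K] A) := fun i => 1 ⊗ₜ[K] (1 ⊗ₜ[K] x i)
  refine coordRing_hom_ext fun i => ?_
  have hl : ∀ j, (Algebra.TensorProduct.assoc K K K A A A).toAlgHom
      ((comulHom K b c (x j)) ⊗ₜ[K] (1 : A)) = mulPt (K := K) b c p q j := by
    intro j
    have h : ∀ t : A ⊗[K] A, (Algebra.TensorProduct.assoc K K K A A A).toAlgHom (t ⊗ₜ[K] (1 : A))
        = ((Algebra.TensorProduct.assoc K K K A A A).toAlgHom.comp
          (Algebra.TensorProduct.includeLeft (R := K) (S := K))) t := fun t => rfl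
    rw [h, comulHom, evalPt_coord, map_mulPt]
    rfl
  have hr : ∀ j, ((1 : A) ⊗ₜ[K] (comulHom K b c (x j))) = mulPt (K := K) b c q r j := by
    intro j
    have h : ∀ t : A ⊗[K] A, (1 : A) ⊗ₜ[K] t
        = (Algebra.TensorProduct.includeRight (R := K)) t := fun t => rfl
    rw [h, comulHom, evalPt_coord, map_mulPt]
    rfl
  have key := congrFun (mulPt_assoc (K := K) b c p q r) i
  have e1 : ((Algebra.TensorProduct.assoc K K K A A A).toAlgHom.comp
        ((Algebra.TensorProduct.map (comulHom K b c) (.id K _)).comp (comulHom K b c)))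
        (coord K b c i) = mulPt (K := K) b c (mulPt (K := K) b c p q) r i := by
    rw [← AlgHom.comp_assoc, AlgHom.comp_apply]
    conv_lhs => arg 2; rw [comulHom, evalPt_coord]
    rw [map_mulPt]
    congr 1
    · funext j
      rw [← hl]
      simp [x]
    · funext j
      rw [AlgHom.comp_apply]
      simp [x, r, Algebra.TensorProduct.one_def]
  have e2 : ((Algebra.TensorProduct.map (.id K _) (comulHom K b c)).comp (comulHom K b c))
        (coord K b c i) = mulPt (K := K) b c p (mulPt (K := K) b c q r) i := by
    rw [AlgHom.comp_apply]
    conv_lhs => arg 2; rw [comulHom, evalPt_coord]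
    rw [map_mulPt]
    congr 1
    · funext j
      simp [p, x, Algebra.TensorProduct.one_def]
    · funext j
      rw [← hr]
      simp [x]
  rw [e1, e2, key]

theorem comulHom_comm :
    (Algebra.TensorProduct.comm K (CoordRing K b c) (CoordRing K b c)).toAlgHom.comp
      (comulHom K b c) = comulHom K b c := by
  refine coordRing_hom_ext fun i => ?_
  rw [AlgHom.comp_apply, comulHom, evalPt_coord, map_mulPt, mulPt_comm]
  rfl

theorem comulHom_rTensor :
    (Algebra.TensorProduct.map (counitHom K b c) (.id K (CoordRing K b c))).comp (comulHom K b c)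
      = (Algebra.TensorProduct.lid K (CoordRing K b c)).symm := by
  refine coordRing_hom_ext fun i => ?_
  rw [AlgHom.comp_apply, comulHom, evalPt_coord, map_mulPt, mulPt_comm]
  have h1 : (fun j => (Algebra.TensorProduct.map (counitHom K b c) (.id K (CoordRing K b c))) (coord K b c j ⊗ₜ[K] 1)) =
      (onePt : Fin 3 → K ⊗[K] CoordRing K b c) := by
    funext j
    rw [Algebra.TensorProduct.map_tmul, counitHom, evalPt_coord, map_one]
    fin_cases j
    · rfl
    · simp [onePt]
    · simp [onePt]
  have h2 : (fun j => (Algebra.TensorProduct.map (counitHom K b c) (.id K (CoordRing K b c))) (1 ⊗ₜ[K] coord K b c j)) =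
      fun j => 1 ⊗ₜ[K] coord K b c j := by
    funext j
    rw [Algebra.TensorProduct.map_tmul, map_one, AlgHom.id_apply]
  rw [h1, h2, mulPt_onePt]
  rfl

theorem comulHom_lTensor :
    (Algebra.TensorProduct.map (.id K (CoordRing K b c)) (counitHom K b c)).comp (comulHom K b c)
      = (Algebra.TensorProduct.rid K K (CoordRing K b c)).symm := by
  refine coordRing_hom_ext fun i => ?_
  rw [AlgHom.comp_apply, comulHom, evalPt_coord, map_mulPt]
  have h1 : (fun j => (Algebra.TensorProduct.map (.id K (CoordRing K b c)) (counitHom K b c)) (1 ⊗ₜ[K] coord K b c j)) =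
      (onePt : Fin 3 → CoordRing K b c ⊗[K] K) := by
    funext j
    rw [Algebra.TensorProduct.map_tmul, counitHom, evalPt_coord, map_one]
    fin_cases j
    · rfl
    · simp [onePt]
    · simp [onePt]
  have h2 : (fun j => (Algebra.TensorProduct.map (.id K (CoordRing K b c)) (counitHom K b c)) (coord K b c j ⊗ₜ[K] 1)) =
      fun j => coord K b c j ⊗ₜ[K] 1 := by
    funext j
    rw [Algebra.TensorProduct.map_tmul, map_one, AlgHom.id_apply]
  rw [h1, h2, mulPt_onePt]
  rfl

instance : Bialgebra K (CoordRing K b c) :=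
  Bialgebra.ofAlgHom (comulHom K b c) (counitHom K b c) (comulHom_coassoc K b c)
    (comulHom_rTensor K b c) (comulHom_lTensor K b c)

instance : Coalgebra.IsCocomm K (CoordRing K b c) where
  comm_comp_comul := congrArg AlgHom.toLinearMap (comulHom_comm K b c)

end SplitMonoid

end

noncomputable section
namespace TwistedForms
open AlgebraicGeometry CategoryTheory Limits MonoidalCategory CartesianMonoidalCategory MonObj

/-- Monoid schemes over a field `K`: monoid objects in the category of `K`-schemes. -/
abbrev MonoidScheme (K : Type u) [Field K] := Mon (Over (Spec (CommRingCat.of K)))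

/-- A monoid scheme over `K` is an algebraic monoid if its underlying scheme is an irreducible
variety over `K`: an irreducible and reduced (i.e. integral) separated scheme of finite type. -/
structure IsAlgebraicMonoid {K : Type u} [Field K] (M : MonoidScheme K) : Prop where
  integral : IsIntegral M.X.left
  separated : IsSeparated M.X.hom
  locallyOfFiniteType : LocallyOfFiniteType M.X.hom
  quasiCompact : QuasiCompact M.X.hom

/-- The morphism `Spec L ⟶ Spec K` of a field extension. -/
abbrev specMap (K L : Type u) [Field K] [Field L] [Algebra K L] :
    Spec (CommRingCat.of L) ⟶ Spec (CommRingCat.of K) :=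
  Spec.map (CommRingCat.ofHom (algebraMap K L))

/-- Base change `M ↦ M ⊗_K L` of monoid schemes along a field extension `L/K`. -/
abbrev baseChange (K L : Type u) [Field K] [Field L] [Algebra K L] :
    MonoidScheme K ⥤ MonoidScheme L :=
  (Over.pullback (specMap K L)).mapMon

/-- `M'` is a twisted `L/K`-form of `M`. -/
def IsTwistedFormOver (K L : Type u) [Field K] [Field L] [Algebra K L]
    (M' M : MonoidScheme K) : Prop :=
  Nonempty ((baseChange K L).obj M ≅ (baseChange K L).obj M')

/-- `M` has no nontrivial twisted forms: every algebraic monoid over `K` that is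
a twisted `L/K`-form of `M` for some finite Galois extension `L/K` is isomorphic to `M`. -/
def HasNoNontrivialTwistedForms {K : Type u} [Field K] (M : MonoidScheme K) : Prop :=
  ∀ M' : MonoidScheme K, IsAlgebraicMonoid M' →
    ∀ (L : Type u) [Field L] [Algebra K L] [FiniteDimensional K L] [IsGalois K L],
      IsTwistedFormOver K L M' M → Nonempty (M' ≅ M)

section galois

variable {K : Type u} [Field K] (L : Type u) [Field L] [Algebra K L] (M : MonoidScheme K)

/-- The group `Aut(M)(L)` of automorphisms of the monoid scheme `M ⊗_K L` over `L`.
The product is composition: `f * g` is `f ∘ g`. -/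
abbrev AutOver := Aut ((baseChange K L).obj M)

variable {L}

/-- `σ` acts on `Spec L` by `Spec (σ⁻¹)` -/
abbrev specGal (σ : L ≃ₐ[K] L) : Spec (CommRingCat.of L) ⟶ Spec (CommRingCat.of L) :=
  Spec.map (CommRingCat.ofHom (σ⁻¹ : L ≃ₐ[K] L).toRingHom)

theorem specGal_specMap (σ : L ≃ₐ[K] L) : specGal σ ≫ specMap K L = specMap K L := by
  rw [← Spec.map_comp, ← CommRingCat.ofHom_comp]
  congr 2
  ext x
  exact (σ⁻¹ : L ≃ₐ[K] L).commutes x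

theorem specGal_one : specGal (1 : L ≃ₐ[K] L) = 𝟙 _ := by
  rw [specGal, inv_one]
  exact Spec.map_id _

theorem specGal_mul (σ τ : L ≃ₐ[K] L) : specGal (σ * τ) = specGal τ ≫ specGal σ := by
  rw [← Spec.map_comp, ← CommRingCat.ofHom_comp, specGal, mul_inv_rev]
  rfl

/-- The projection `M ⊗_K L = M ×_{Spec K} Spec L ⟶ M`. -/
def proj (M : MonoidScheme K) (L : Type u) [Field L] [Algebra K L] :
    ((baseChange K L).obj M).X.left ⟶ M.X.left :=
  pullback.fst M.X.hom (specMap K L)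

theorem proj_hom : proj M L ≫ M.X.hom = ((baseChange K L).obj M).X.hom ≫ specMap K L :=
  pullback.condition

variable {M} in
theorem baseChange_hom_ext {T : Scheme.{u}} {f g : T ⟶ ((baseChange K L).obj M).X.left}
    (h₁ : f ≫ proj M L = g ≫ proj M L)
    (h₂ : f ≫ ((baseChange K L).obj M).X.hom = g ≫ ((baseChange K L).obj M).X.hom) : f = g :=
  pullback.hom_ext h₁ h₂

/-- The semilinear action of `σ` on `M ⊗_K L = M ×_{Spec K} Spec L` through the second factor,
by automorphisms of `K`-schemes. -/
def galHom (σ : L ≃ₐ[K] L) :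
    ((baseChange K L).obj M).X.left ⟶ ((baseChange K L).obj M).X.left :=
  pullback.lift (proj M L) (((baseChange K L).obj M).X.hom ≫ specGal σ)
    (by rw [proj_hom, Category.assoc, specGal_specMap])

theorem galHom_proj (σ : L ≃ₐ[K] L) : galHom M σ ≫ proj M L = proj M L :=
  pullback.lift_fst _ _ _

theorem galHom_hom (σ : L ≃ₐ[K] L) : galHom M σ ≫ ((baseChange K L).obj M).X.hom =
    ((baseChange K L).obj M).X.hom ≫ specGal σ :=
  pullback.lift_snd _ _ _

theorem galHom_one : galHom M (1 : L ≃ₐ[K] L) = 𝟙 _ := by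
  apply baseChange_hom_ext
  · rw [galHom_proj, Category.id_comp]
  · rw [galHom_hom, specGal_one, Category.id_comp, Category.comp_id]

theorem galHom_mul (σ τ : L ≃ₐ[K] L) : galHom M (σ * τ) = galHom M τ ≫ galHom M σ := by
  apply baseChange_hom_ext
  · rw [Category.assoc, galHom_proj, galHom_proj, galHom_proj]
  · rw [Category.assoc, galHom_hom, galHom_hom, ← Category.assoc, galHom_hom, specGal_mul,
      Category.assoc]

theorem galHom_inv (σ : L ≃ₐ[K] L) : galHom M σ⁻¹ ≫ galHom M σ = 𝟙 _ := by
  rw [← galHom_mul, mul_inv_cancel, galHom_one]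

theorem galHom_inv' (σ : L ≃ₐ[K] L) : galHom M σ ≫ galHom M σ⁻¹ = 𝟙 _ := by
  rw [← galHom_mul, inv_mul_cancel, galHom_one]

theorem specGal_inv (σ : L ≃ₐ[K] L) : specGal σ⁻¹ ≫ specGal σ = 𝟙 _ := by
  rw [← specGal_mul, mul_inv_cancel, specGal_one]

/-- The map `f ×_i f` between fibre products, for `f` lying over `i`. -/
def prodMap {X Y S T : Scheme.{u}} (p : X ⟶ S) (q : Y ⟶ T) (f : X ⟶ Y) (i : S ⟶ T)
    (h : f ≫ q = p ≫ i) : pullback p p ⟶ pullback q q :=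
  pullback.map p p q q f f i h.symm h.symm

theorem prodMap_fst {X Y S T : Scheme.{u}} (p : X ⟶ S) (q : Y ⟶ T) (f : X ⟶ Y) (i : S ⟶ T)
    (h : f ≫ q = p ≫ i) : prodMap p q f i h ≫ pullback.fst q q = pullback.fst p p ≫ f :=
  pullback.lift_fst _ _ _

theorem prodMap_snd {X Y S T : Scheme.{u}} (p : X ⟶ S) (q : Y ⟶ T) (f : X ⟶ Y) (i : S ⟶ T)
    (h : f ≫ q = p ≫ i) : prodMap p q f i h ≫ pullback.snd q q = pullback.snd p p ≫ f :=
  pullback.lift_snd _ _ _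

theorem prodMap_comp {X Y Z S T U : Scheme.{u}} {p : X ⟶ S} {q : Y ⟶ T} {r : Z ⟶ U}
    {f : X ⟶ Y} {g : Y ⟶ Z} {i : S ⟶ T} {j : T ⟶ U} (h : f ≫ q = p ≫ i) (k : g ≫ r = q ≫ j)
    {f' : X ⟶ Z} {i' : S ⟶ U} (h' : f' ≫ r = p ≫ i') (e : f ≫ g = f') :
    prodMap p q f i h ≫ prodMap q r g j k = prodMap p r f' i' h' := by
  apply pullback.hom_ext
  · rw [Category.assoc, prodMap_fst, prodMap_fst, ← Category.assoc, prodMap_fst, Category.assoc, e]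
  · rw [Category.assoc, prodMap_snd, prodMap_snd, ← Category.assoc, prodMap_snd, Category.assoc, e]

/-- The unit section of `M ⊗_K L`, as a morphism of schemes. -/
def oneMor (M : MonoidScheme K) (L : Type u) [Field L] [Algebra K L] :
    Spec (CommRingCat.of L) ⟶ ((baseChange K L).obj M).X.left :=
  (η[((baseChange K L).obj M).X]).left

/-- The multiplication of `M ⊗_K L`, as a morphism of schemes. -/
def mulMor (M : MonoidScheme K) (L : Type u) [Field L] [Algebra K L] :
    pullback ((baseChange K L).obj M).X.hom ((baseChange K L).obj M).X.hom ⟶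
      ((baseChange K L).obj M).X.left :=
  (μ[((baseChange K L).obj M).X]).left

theorem oneMor_hom : oneMor M L ≫ ((baseChange K L).obj M).X.hom = 𝟙 _ :=
  Over.w η[((baseChange K L).obj M).X]

theorem mulMor_hom : mulMor M L ≫ ((baseChange K L).obj M).X.hom =
      pullback.fst _ _ ≫ ((baseChange K L).obj M).X.hom :=
  Over.w μ[((baseChange K L).obj M).X]

/-- The unit section of `M`, as a morphism of schemes. -/
def oneMorBase (M : MonoidScheme K) : Spec (CommRingCat.of K) ⟶ M.X.left := (η[M.X]).left

/-- The multiplication of `M`, as a morphism of schemes. -/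
def mulMorBase (M : MonoidScheme K) : pullback M.X.hom M.X.hom ⟶ M.X.left := (μ[M.X]).left

theorem oneMor_proj : oneMor M L ≫ proj M L = specMap K L ≫ oneMorBase M := by
  have h2 : ((Over.pullback (specMap K L)).map η[M.X]).left ≫ proj M L =
      pullback.fst (𝟙 _) (specMap K L) ≫ oneMorBase M :=
    pullback.lift_fst _ _ _
  have h3 : inv (pullback.snd (𝟙 _) (specMap K L)) ≫ pullback.fst (𝟙 _) (specMap K L) =
      specMap K L := by
    rw [IsIso.inv_comp_eq, ← pullback.condition, Category.comp_id]
  refine (Category.assoc (Functor.LaxMonoidal.ε (Over.pullback (specMap K L))).left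
    ((Over.pullback (specMap K L)).map η[M.X]).left (proj M L)).trans ?_
  refine (congrArg _ h2).trans ?_
  refine (congrArg (· ≫ (pullback.fst (𝟙 _) (specMap K L) ≫ oneMorBase M))
    (Over.ε_pullback_left (f := specMap K L))).trans ?_
  refine (Category.assoc _ _ _).symm.trans ?_
  exact congrArg (· ≫ oneMorBase M) h3

theorem mulMor_proj : mulMor M L ≫ proj M L =
    prodMap _ _ (proj M L) (specMap K L) (proj_hom M) ≫ mulMorBase M := by
  have h2 : ((Over.pullback (specMap K L)).map μ[M.X]).left ≫ proj M L =
      pullback.fst (M.X ⊗ M.X).hom (specMap K L) ≫ mulMorBase M :=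
    pullback.lift_fst _ _ _
  refine (Category.assoc (Functor.LaxMonoidal.μ (Over.pullback (specMap K L)) M.X M.X).left
    ((Over.pullback (specMap K L)).map μ[M.X]).left (proj M L)).trans ?_
  refine (congrArg _ h2).trans ?_
  refine (Category.assoc _ _ _).symm.trans ?_
  refine congrArg (· ≫ mulMorBase M) ?_
  apply pullback.hom_ext
  · exact ((Category.assoc _ _ _).trans (Over.μ_pullback_left_fst_fst _ _)).trans
      (prodMap_fst _ _ _ _ _).symm
  · exact ((Category.assoc _ _ _).trans (Over.μ_pullback_left_fst_snd _ _)).trans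
      (prodMap_snd _ _ _ _ _).symm

theorem specGal_oneMor (σ : L ≃ₐ[K] L) :
    specGal σ ≫ oneMor M L = oneMor M L ≫ galHom M σ := by
  apply baseChange_hom_ext
  · rw [Category.assoc, Category.assoc, galHom_proj, oneMor_proj, ← Category.assoc, specGal_specMap]
  · rw [Category.assoc, Category.assoc, galHom_hom, oneMor_hom, ← Category.assoc, oneMor_hom,
      Category.comp_id, Category.id_comp]

theorem prodMap_mulMor (σ : L ≃ₐ[K] L) :
    prodMap _ _ (galHom M σ) (specGal σ) (galHom_hom M σ) ≫ mulMor M L =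
      mulMor M L ≫ galHom M σ := by
  apply baseChange_hom_ext
  · rw [Category.assoc, Category.assoc, galHom_proj, mulMor_proj, ← Category.assoc]
    congr 1
    exact prodMap_comp _ _ _ (galHom_proj M σ)
  · rw [Category.assoc, Category.assoc, galHom_hom, mulMor_hom, ← Category.assoc, prodMap_fst,
      ← Category.assoc, mulMor_hom, Category.assoc, Category.assoc, galHom_hom]

/-- A morphism of schemes underlying an endomorphism of `M ⊗_K L` as a monoid scheme over `L`. -/
structure IsMonoidHom (f : ((baseChange K L).obj M).X.left ⟶ ((baseChange K L).obj M).X.left) :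
    Prop where
  isOver : f ≫ ((baseChange K L).obj M).X.hom = ((baseChange K L).obj M).X.hom
  one : oneMor M L ≫ f = oneMor M L
  mul : mulMor M L ≫ f =
    prodMap _ _ f (𝟙 _) (isOver.trans (Category.comp_id _).symm) ≫ mulMor M L

variable {M}

theorem isMonoidHom_left (f : (baseChange K L).obj M ⟶ (baseChange K L).obj M) :
    IsMonoidHom M f.hom.left where
  isOver := Over.w f.hom
  one := congrArg Over.Hom.left (IsMonHom.one_hom f.hom)
  mul := congrArg Over.Hom.left (IsMonHom.mul_hom f.hom)

/-- The endomorphism of monoid schemes with a given underlying morphism of schemes. -/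
def IsMonoidHom.toHom {f : ((baseChange K L).obj M).X.left ⟶ ((baseChange K L).obj M).X.left}
    (h : IsMonoidHom M f) : (baseChange K L).obj M ⟶ (baseChange K L).obj M :=
  Mon.Hom.mk' (Over.homMk f h.isOver) (by ext1; exact h.one) (by ext1; exact h.mul)

/-- Conjugation by `σ` preserves endomorphisms of the monoid scheme `M ⊗_K L`. -/
theorem IsMonoidHom.conj
    {f : ((baseChange K L).obj M).X.left ⟶ ((baseChange K L).obj M).X.left}
    (h : IsMonoidHom M f) (σ : L ≃ₐ[K] L) :
    IsMonoidHom M (galHom M σ⁻¹ ≫ f ≫ galHom M σ) := by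
  have ho : (galHom M σ⁻¹ ≫ f ≫ galHom M σ) ≫ ((baseChange K L).obj M).X.hom =
      ((baseChange K L).obj M).X.hom := by
    simp only [Category.assoc]
    rw [galHom_hom, ← Category.assoc f, h.isOver, ← Category.assoc, galHom_hom, Category.assoc,
      specGal_inv, Category.comp_id]
  refine ⟨ho, ?_, ?_⟩
  · rw [← Category.assoc, ← specGal_oneMor, Category.assoc, ← Category.assoc (oneMor M L), h.one,
      ← specGal_oneMor, ← Category.assoc, specGal_inv, Category.id_comp]
  · rw [← Category.assoc, ← prodMap_mulMor, Category.assoc, ← Category.assoc (mulMor M L), h.mul,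
      Category.assoc, ← prodMap_mulMor, ← Category.assoc, ← Category.assoc]
    congr 1
    rw [Category.assoc, prodMap_comp (h' := by
        rw [Category.assoc, galHom_hom, ← Category.assoc, h.isOver]) (e := rfl),
      prodMap_comp (e := rfl)]


theorem autOver_ext {f g : AutOver L M} (h : f.hom.hom.left = g.hom.hom.left) : f = g := by
  apply Iso.ext
  apply Mon.Hom.ext
  exact Over.OverMorphism.ext h

theorem hom_inv_left (f : AutOver L M) : f.hom.hom.left ≫ f.inv.hom.left = 𝟙 _ :=
  congrArg (fun t => t.hom.left) f.hom_inv_id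

theorem inv_hom_left (f : AutOver L M) : f.inv.hom.left ≫ f.hom.hom.left = 𝟙 _ :=
  congrArg (fun t => t.hom.left) f.inv_hom_id

theorem conj_comp_conj {f g h : ((baseChange K L).obj M).X.left ⟶ ((baseChange K L).obj M).X.left}
    (e : f ≫ g = h) (σ : L ≃ₐ[K] L) : (galHom M σ⁻¹ ≫ f ≫ galHom M σ) ≫
      (galHom M σ⁻¹ ≫ g ≫ galHom M σ) = galHom M σ⁻¹ ≫ h ≫ galHom M σ := by
  rw [← e]
  simp only [Category.assoc]
  rw [← Category.assoc (galHom M σ) (galHom M σ⁻¹), galHom_inv', Category.id_comp]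

theorem conj_id (σ : L ≃ₐ[K] L) :
    galHom M σ⁻¹ ≫ 𝟙 _ ≫ galHom M σ = 𝟙 _ := by
  rw [Category.id_comp, galHom_inv]

/-- The action of the Galois group on `Aut(M)(L)`: the automorphism `σ • f` is the conjugate
`σ ∘ f ∘ σ⁻¹`, where `σ` acts on `M ⊗_K L` by `galHom`. -/
instance : SMul (L ≃ₐ[K] L) (AutOver L M) where
  smul σ f :=
    { hom := ((isMonoidHom_left f.hom).conj σ).toHom
      inv := ((isMonoidHom_left f.inv).conj σ).toHom
      hom_inv_id := by
        apply Mon.Hom.ext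
        apply Over.OverMorphism.ext
        exact (conj_comp_conj (hom_inv_left f) σ).trans (conj_id σ)
      inv_hom_id := by
        apply Mon.Hom.ext
        apply Over.OverMorphism.ext
        exact (conj_comp_conj (inv_hom_left f) σ).trans (conj_id σ) }

theorem smul_hom_left (σ : L ≃ₐ[K] L) (f : AutOver L M) :
    (σ • f).hom.hom.left = galHom M σ⁻¹ ≫ f.hom.hom.left ≫ galHom M σ := rfl

theorem mul_hom_left (f g : AutOver L M) :
    (f * g).hom.hom.left = g.hom.hom.left ≫ f.hom.hom.left := rfl

instance : MulDistribMulAction (L ≃ₐ[K] L) (AutOver L M) where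
  one_smul f := autOver_ext (by
    rw [smul_hom_left, inv_one, galHom_one, Category.id_comp, Category.comp_id])
  mul_smul σ τ f := autOver_ext (by
    rw [smul_hom_left, smul_hom_left, smul_hom_left, mul_inv_rev, galHom_mul, galHom_mul]
    simp only [Category.assoc])
  smul_one σ := autOver_ext (conj_id σ)
  smul_mul σ f g := autOver_ext (by
    rw [mul_hom_left, smul_hom_left, smul_hom_left, smul_hom_left]
    exact (conj_comp_conj rfl σ).symm)

end galois

section cohomology

variable (Γ A : Type*) [Group Γ] [Group A] [MulDistribMulAction Γ A]

/-- Cocycles: maps `f : Γ → A` with `f (τ ρ) = f τ * τ • f ρ`. -/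
def Cocycle := {f : Γ → A // ∀ τ ρ : Γ, f (τ * ρ) = f τ * τ • f ρ}

/-- Cocycles `f` and `g` are equivalent if `g σ = a * f σ * (σ • a)⁻¹` for some `a`. -/
def cocycleSetoid : Setoid (Cocycle Γ A) where
  r f g := ∃ a : A, ∀ σ : Γ, g.1 σ = a * f.1 σ * (σ • a)⁻¹
  iseqv :=
    { refl := fun f => ⟨1, fun σ => by simp⟩
      symm := fun {f g} ⟨a, h⟩ => ⟨a⁻¹, fun σ => by rw [h σ, smul_inv']; group⟩
      trans := fun {f g k} ⟨a, h⟩ ⟨a', h'⟩ => ⟨a' * a, fun σ => by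
        rw [h' σ, h σ, smul_mul']; group⟩ }

/-- The nonabelian first cohomology set. -/
def H1 := Quotient (cocycleSetoid Γ A)

/-- The base point of the first cohomology set: the class of the trivial cocycle. -/
def H1.base : H1 Γ A := Quotient.mk (cocycleSetoid Γ A) ⟨fun _ => 1, fun _ _ => by simp⟩

end cohomology

section limit

variable {K : Type u} [Field K] (M : MonoidScheme K)

theorem specMap_comp {L L' : Type u} [Field L] [Algebra K L] [Field L'] [Algebra K L']
    (j : L →ₐ[K] L') :
    Spec.map (CommRingCat.ofHom (j : L →+* L')) ≫ specMap K L = specMap K L' := by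
  rw [← Spec.map_comp, ← CommRingCat.ofHom_comp, AlgHom.comp_algebraMap]

/-- The canonical morphism `M ⊗_K L' ⟶ M ⊗_K L` for a `K`-embedding `j` of `L` into `L'`. -/
def baseChangeProj {L L' : Type u} [Field L] [Algebra K L] [Field L'] [Algebra K L']
    (j : L →ₐ[K] L') :
    ((baseChange K L').obj M).X.left ⟶ ((baseChange K L).obj M).X.left :=
  pullback.lift (proj M L')
    (((baseChange K L').obj M).X.hom ≫ Spec.map (CommRingCat.ofHom (j : L →+* L')))
    (by rw [proj_hom, Category.assoc, specMap_comp])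

/-- `f'` is the inflation of `f` along `L ⟶ L'`: for every `σ' ∈ Gal(L'/K)` with restriction
`σ ∈ Gal(L/K)`, the automorphism `f' σ'` of `M ⊗_K L'` is the base change of the automorphism
`f σ` of `M ⊗_K L`. -/
def IsInflation {L L' : Type u} [Field L] [Algebra K L] [Field L'] [Algebra K L']
    (j : L →ₐ[K] L') (f : Cocycle (L ≃ₐ[K] L) (AutOver L M))
    (f' : Cocycle (L' ≃ₐ[K] L') (AutOver L' M)) : Prop :=
  ∀ (σ : L ≃ₐ[K] L) (σ' : L' ≃ₐ[K] L'), (∀ x : L, σ' (j x) = j (σ x)) →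
    (f'.1 σ').hom.hom.left ≫ baseChangeProj M j = baseChangeProj M j ≫ (f.1 σ).hom.hom.left

/-- The disjoint union of the sets `H¹(Gal(L/K), Aut(M)(L))` over all finite Galois extensions
`L` of `K` inside the algebraic closure. -/
def FiniteLevelH1 : Type u :=
  Σ F : FiniteGaloisIntermediateField K (AlgebraicClosure K), H1 (F ≃ₐ[K] F) (AutOver F M)

/-- The transition maps of the direct system of the `H¹(Gal(L/K), Aut(M)(L))`, as a relation. -/
def inflationRel (x y : FiniteLevelH1 M) : Prop :=
  ∃ (h : x.1.toIntermediateField ≤ y.1.toIntermediateField)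
    (f : Cocycle (x.1 ≃ₐ[K] x.1) (AutOver x.1 M)) (f' : Cocycle (y.1 ≃ₐ[K] y.1) (AutOver y.1 M)),
    Quotient.mk (cocycleSetoid _ _) f = x.2 ∧ Quotient.mk (cocycleSetoid _ _) f' = y.2 ∧
      IsInflation M (IntermediateField.inclusion h) f f'

/-- `H¹(Gal(K̄/K), Aut(M))`, the direct limit of the sets `H¹(Gal(L/K), Aut(M)(L))` over all finite
Galois extensions `L` of `K` inside the algebraic closure. -/
def AbsoluteH1 := Quot (inflationRel M)

/-- The base point of `H¹(Gal(K̄/K), Aut(M))`. -/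
def AbsoluteH1.base : AbsoluteH1 M := Quot.mk _ ⟨⊥, H1.base _ _⟩

end limit

end TwistedForms

namespace SplitMonoid
open AlgebraicGeometry CategoryTheory TwistedForms

/-- The monoid scheme `(x₁, x₂, x₃) * (y₁, y₂, y₃) =
(x₁y₁, x₁ᵇ y₂ + y₁ᵇ x₂, x₁ᶜ y₃ + y₁ᶜ x₃ + Q_{b,c}(x₁, y₁, x₂, y₂))` on `𝔸³ = Spec K[x₁, x₂, x₃]`. -/
def splitMonoid (K : Type u) [Field K] (b c : ℕ) : MonoidScheme K :=
  (bialgSpec (CommRingCat.of K)).obj (.op (CommBialgCat.of K (CoordRing K b c)))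

section

variable (K : Type u) [Field K] (b c : ℕ)

theorem splitMonoid_left :
    (splitMonoid K b c).X.left = Spec (CommRingCat.of (CoordRing K b c)) := rfl

instance : IsDomain (CoordRing K b c) := inferInstanceAs (IsDomain (MvPolynomial (Fin 3) K))

instance : Algebra.FiniteType K (CoordRing K b c) :=
  inferInstanceAs (Algebra.FiniteType K (MvPolynomial (Fin 3) K))

theorem isAlgebraicMonoid_splitMonoid : IsAlgebraicMonoid (splitMonoid K b c) where
  integral := inferInstanceAs (IsIntegral (Spec (CommRingCat.of (CoordRing K b c))))
  separated := inferInstanceAs (IsSeparated (Spec.map (CommRingCat.ofHom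
    (algebraMap K (CoordRing K b c)))))
  quasiCompact := inferInstanceAs (QuasiCompact (Spec.map (CommRingCat.ofHom
    (algebraMap K (CoordRing K b c)))))
  locallyOfFiniteType := inferInstanceAs (LocallyOfFiniteType
    (Spec (CommRingCat.of (CoordRing K b c)) ↘ Spec (CommRingCat.of K)))

instance : IsCommMonObj (splitMonoid K b c).X :=
  inferInstanceAs (IsCommMonObj ((Spec (CommRingCat.of (CoordRing K b c))).asOver
    (Spec (CommRingCat.of K))))

variable (L : Type u) [Field L] [Algebra K L]

/-- The coordinate functions `x₁, x₂, x₃` on `M ⊗_K L`. -/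
def coordFun (i : Fin 3) : Γ(((baseChange K L).obj (splitMonoid K b c)).X.left, ⊤) :=
  (proj (splitMonoid K b c) L).appTop.hom
    ((Scheme.ΓSpecIso (CommRingCat.of (CoordRing K b c))).inv.hom (coord K b c i))

/-- The constant functions on `M ⊗_K L`. -/
def constFun : L →+* Γ(((baseChange K L).obj (splitMonoid K b c)).X.left, ⊤) :=
  (((baseChange K L).obj (splitMonoid K b c)).X.hom.appTop.hom).comp
    (Scheme.ΓSpecIso (CommRingCat.of L)).inv.hom

variable {K b c L} in
/-- The pullback of functions along an automorphism of `M ⊗_K L`. -/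
def pullbackFun (f : AutOver L (splitMonoid K b c)) :
    Γ(((baseChange K L).obj (splitMonoid K b c)).X.left, ⊤) →+*
      Γ(((baseChange K L).obj (splitMonoid K b c)).X.left, ⊤) :=
  f.hom.hom.left.appTop.hom

end

/-- The group of invertible matrices `[[α, 0], [γ, α^(d+1)]]` over `L`. -/
def matrixGroup (L : Type*) [Field L] (d : ℕ) : Subgroup (GL (Fin 2) L) where
  carrier := {g | g 0 1 = 0 ∧ g 1 1 = g 0 0 ^ (d + 1)}
  one_mem' := by simp
  mul_mem' := by
    rintro g h ⟨hg, hg'⟩ ⟨hh, hh'⟩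
    constructor
    · simp [Matrix.mul_apply, Fin.sum_univ_two, hg, hh]
    · simp [Matrix.mul_apply, Fin.sum_univ_two, hg, hh, hg', hh', mul_pow]
  inv_mem' := by
    rintro g ⟨hg, hg'⟩
    have hm : ((g⁻¹ : GL (Fin 2) L) : Matrix (Fin 2) (Fin 2) L) * (g : Matrix (Fin 2) (Fin 2) L)
      = 1 := by rw [← Units.val_mul, inv_mul_cancel, Units.val_one]
    have h00 := congrFun (congrFun hm 0) 0
    have h01 := congrFun (congrFun hm 0) 1
    have h11 := congrFun (congrFun hm 1) 1
    simp only [Matrix.mul_apply, Fin.sum_univ_two, hg, hg', mul_zero, zero_add,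
      Matrix.one_apply_eq, ne_eq, zero_ne_one, not_false_eq_true, Matrix.one_apply_ne] at h00 h01 h11
    have hne : g 0 0 ^ (d + 1) ≠ 0 := right_ne_zero_of_mul_eq_one h11
    have h01' : (g⁻¹ : GL (Fin 2) L) 0 1 = 0 := (mul_eq_zero.mp h01).resolve_right hne
    rw [h01', zero_mul, add_zero] at h00
    refine ⟨h01', mul_right_cancel₀ hne ?_⟩
    rw [← mul_pow, h00, one_pow, h11]

/-- The action `α • γ = α^d γ` of `Lˣ` on the additive group of `L`. -/
def twistAction (L : Type*) [Field L] (d : ℕ) : Lˣ →* MulAut (Multiplicative L) where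
  toFun α := AddEquiv.toMultiplicative (DistribMulAction.toAddEquiv L (α ^ d))
  map_one' := by ext; simp
  map_mul' α β := by ext; simp [mul_pow, mul_smul]

end SplitMonoid
end

/-! Write d = c / b and e = c % b. Over a field L of characteristic zero, a point of L³ with x₁ ≠ 0
factors as (x₁, 0, 0) * (1, s, s^(d+1)) * (1, 0, w) with s = x₂/x₁^b (`eq_mulPt_mulPt`). The first
factor runs through a multiplicative submonoid, the other two through copies of the additive group;
for the curve s ↦ (1, s, s^(d+1)) this is because Q at x₁ = y₁ = 1 equals (s+t)^(d+1) - s^(d+1) -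
t^(d+1). A polynomial endomorphism is thus determined by its restrictions to three curves, where its
components satisfy functional equations with only the obvious polynomial solutions. The first
component is a power of x₁, and invertibility makes the exponent 1. The other two are then known on
x₁ ≠ 0 up to constants, and being polynomial across x₁ = 0 cuts these down to α and γ
(`IsPolyHom.exists_eq_of_comp_eq`). Translated to schemes, this says that every automorphism of M
⊗_K L comes from a matrix (`exists_eq_matrixMor`).

The Galois group acts on these matrices entrywise. Multiplicative Hilbert 90 trivialises the
diagonal of a cocycle, and additive Hilbert 90 then trivialises the remaining entry
(`exists_matrix_of_cocycle`), so all the cohomology sets are trivial.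

An isomorphism φ : M ⊗_K L ≅ M' ⊗_K L yields the cocycle σ ↦ φ⁻¹ ∘ σ(φ). If it is a coboundary, φ
can be corrected by an automorphism of M ⊗_K L to become Galois equivariant, and it then descends to
K. Descent works because M ⊗_K L ⟶ M is an effective epimorphism and two points of M ⊗_K L with the
same image in M differ locally by a Galois element (`exists_specGal_of_comp_specMap_eq`,
`exists_descent`). -/

noncomputable section
namespace SplitMonoid

/-! ### Functional equations for polynomials in one variable -/

section univariate

variable {L : Type*} [Field L] [CharZero L]

/-- For m ≠ n the coefficients of t^m give 2^m pₘ = 2^n pₘ, and distinct powers of 2 stay distinct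
in characteristic zero. The term a t^n covers the rule p(st) = s^n p(t) + t^n p(s), taken at s = 2
with a = p(2). -/
theorem eval_eq_mul_pow_of_eval_two_mul {p : Polynomial L} {n : ℕ} {a : L}
    (h : ∀ t, p.eval (2 * t) = 2 ^ n * p.eval t + a * t ^ n) (t : L) :
    p.eval t = p.eval 1 * t ^ n := by
  have hp : p.comp (.C 2 * .X) = .C (2 ^ n) * p + .C a * .X ^ n :=
    Polynomial.funext fun t => by simpa using h t
  have hc : ∀ m, m ≠ n → p.coeff m = 0 := by
    intro m hm
    have h1 := congrArg (Polynomial.coeff · m) hp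
    simp only [Polynomial.comp_C_mul_X_coeff, Polynomial.coeff_add, Polynomial.coeff_C_mul,
      Polynomial.coeff_X_pow, if_neg hm, mul_zero, add_zero] at h1
    have h2 : (2 : L) ^ m ≠ 2 ^ n := fun h =>
      hm (Nat.pow_right_injective le_rfl (by exact_mod_cast h))
    exact (mul_eq_zero.mp (by linear_combination h1 : p.coeff m * ((2 : L) ^ m - 2 ^ n) = 0)).resolve_right
      (sub_ne_zero.mpr h2)
  have hm : p = .C (p.coeff n) * .X ^ n := by
    ext m
    rcases eq_or_ne m n with rfl | hm
    · simp
    · simp [hc m hm, Polynomial.coeff_X_pow, hm]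
  rw [hm]
  simp

theorem eval_eq_mul_of_additive {p : Polynomial L}
    (h : ∀ s t, p.eval (s + t) = p.eval s + p.eval t) (t : L) : p.eval t = p.eval 1 * t := by
  have := eval_eq_mul_pow_of_eval_two_mul (p := p) (n := 1) (a := 0)
    (fun t => by rw [two_mul, h]; ring) t
  simpa using this

/-- From p(s) p(-s) = 1, the polynomial is a unit of L[X], hence constant. -/
theorem eval_eq_one_of_exponential {p : Polynomial L} (h0 : p.eval 0 = 1)
    (h : ∀ s t, p.eval (s + t) = p.eval s * p.eval t) (t : L) : p.eval t = 1 := by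
  have hu : p * p.comp (-.X) = 1 := Polynomial.funext fun s => by
    have := h s (-s)
    rw [add_neg_cancel, h0] at this
    simp [← this]
  obtain ⟨a, -, rfl⟩ := Polynomial.isUnit_iff.mp (IsUnit.of_mul_eq_one _ hu)
  simpa using h0

/-- Choose n with pₙ ≠ 0. The coefficient of t^n in p(2t) = p(2) p(t) gives p(2) = 2^n, which
reduces to `eval_eq_mul_pow_of_eval_two_mul` with a = 0. -/
theorem exists_eval_eq_pow_of_multiplicative {p : Polynomial L} (h1 : p.eval 1 = 1)
    (h : ∀ s t, p.eval (s * t) = p.eval s * p.eval t) : ∃ n : ℕ, ∀ t, p.eval t = t ^ n := by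
  have hp0 : p ≠ 0 := by rintro rfl; simp at h1
  obtain ⟨n, hn⟩ : ∃ n, p.coeff n ≠ 0 := by
    by_contra! hc
    exact hp0 (Polynomial.ext hc)
  have hp : p.comp (.C 2 * .X) = .C (p.eval 2) * p :=
    Polynomial.funext fun t => by simpa using h 2 t
  have h2 : p.eval 2 = 2 ^ n := by
    have := congrArg (Polynomial.coeff · n) hp
    simp only [Polynomial.comp_C_mul_X_coeff, Polynomial.coeff_C_mul] at this
    exact mul_right_cancel₀ hn (by linear_combination -this)
  refine ⟨n, fun t => ?_⟩
  have := eval_eq_mul_pow_of_eval_two_mul (p := p) (n := n) (a := 0)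
    (fun t => by rw [h, h2]; ring) t
  rw [this, h1, one_mul]

omit [CharZero L] in
-- Restriction to a parametrised curve: this is how the univariate lemmas reach polynomials in three
-- variables.
theorem exists_polynomial_eval_eq (F : MvPolynomial (Fin 3) L) (g : Fin 3 → Polynomial L) :
    ∃ p : Polynomial L, ∀ s, p.eval s = eval (fun i => (g i).eval s) F := by
  refine ⟨aeval g F, fun s => ?_⟩
  have : (Polynomial.evalRingHom s).comp (aeval g : MvPolynomial (Fin 3) L →ₐ[L] _).toRingHom =
      eval (fun i => (g i).eval s) := by
    ext i <;> simp
  exact RingHom.congr_fun this F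

/-- After multiplication by `X 0` the two sides agree at all points, and L is infinite. Hence it
suffices to work where x₁ is invertible. -/
theorem eq_of_eval_eq_of_ne_zero {F G : MvPolynomial (Fin 3) L}
    (h : ∀ x : Fin 3 → L, x 0 ≠ 0 → eval x F = eval x G) : F = G := by
  refine mul_left_cancel₀ (X_ne_zero (R := L) (0 : Fin 3)) (MvPolynomial.funext fun x => ?_)
  rcases eq_or_ne (x 0) 0 with hx | hx
  · simp [hx]
  · simp [h x hx]

end univariate

/-! ### Polynomial endomorphisms of the monoid L³ -/

section endomorphisms

variable (K : Type*) [Field K] (b c : ℕ) {L : Type*} [Field L] [Algebra K L]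

/-- The triple of polynomials `F` defines a monoid endomorphism of `L³`. -/
structure IsPolyHom (F : Fin 3 → MvPolynomial (Fin 3) L) : Prop where
  one : ∀ i, eval onePt (F i) = onePt i
  mul : ∀ (x y : Fin 3 → L) i, eval (mulPt (K := K) b c x y) (F i) =
    mulPt (K := K) b c (fun j => eval x (F j)) (fun j => eval y (F j)) i

variable {K b c}

theorem QPt_eq_zero_of_ne {B : Type*} [CommRing B] [IsDomain B] [Algebra K B] {x y : Fin 3 → B}
    (hx : x 0 ≠ 0) (hy : y 0 ≠ 0) (h : y 1 = 0) : QPt (K := K) b c x y = 0 := by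
  have e := denom_mul_QPt (K := K) b c x y
  apply mul_left_cancel₀ (pow_ne_zero (b - c % b) (mul_ne_zero hx hy))
  rw [e, h]
  simp

/-- The denominator of Q cannot be cancelled in a general ring. The identity is proved at the
generic pair of points in a polynomial ring, where it can, and then specialised along `φ`. -/
theorem QPt_eq_zero {B : Type*} [CommRing B] [Algebra K B] {x y : Fin 3 → B} (h : y 1 = 0) :
    QPt (K := K) b c x y = 0 := by
  let f : Fin 3 → MvPolynomial (Fin 2 × Fin 3) K := fun i => X (0, i)
  let g : Fin 3 → MvPolynomial (Fin 2 × Fin 3) K := ![X (1, 0), 0, X (1, 2)]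
  let φ : MvPolynomial (Fin 2 × Fin 3) K →ₐ[K] B := aeval fun p => ![x, y] p.1 p.2
  have key := congrArg φ (QPt_eq_zero_of_ne (K := K) (b := b) (c := c) (x := f) (y := g)
    (X_ne_zero _) (X_ne_zero _) rfl)
  have h0 : (fun j => φ (f j)) = x := by funext j; simp [φ, f]
  have h1 : (fun j => φ (g j)) = y := by funext j; fin_cases j <;> simp [φ, g, h]
  simpa only [map_QPt, h0, h1, map_zero] using key

theorem mulPt_torus (s t : L) :
    mulPt (K := K) b c ![s, 0, 0] ![t, 0, 0] = ![s * t, 0, 0] := by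
  have := QPt_eq_zero (K := K) (b := b) (c := c) (x := ![s, 0, 0]) (y := ![t, 0, 0]) rfl
  funext i
  fin_cases i
  · simp [mulPt_zero]
  · simp [mulPt_one]
  · simp [mulPt_two, this]

theorem QPt_of_one (s t p q : L) :
    QPt (K := K) b c ![1, s, p] ![1, t, q] =
      (s + t) ^ (c / b + 1) - s ^ (c / b + 1) - t ^ (c / b + 1) := by
  have e := denom_mul_QPt (K := K) b c ![1, s, p] ![1, t, q]
  simp only [Matrix.cons_val_zero, Matrix.cons_val_one, one_pow, one_mul] at e
  rw [e]
  ring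

/-- On points with first coordinate 1 the cocycle Q is the coboundary of s ↦ s^(d+1), so this third
coordinate makes the curve a copy of the additive group. -/
theorem mulPt_curve (s t : L) :
    mulPt (K := K) b c ![1, s, s ^ (c / b + 1)] ![1, t, t ^ (c / b + 1)] =
      ![1, s + t, (s + t) ^ (c / b + 1)] := by
  funext i
  fin_cases i
  · simp [mulPt_zero]
  · simp [mulPt_one, add_comm]
  · simp only [Fin.reduceFinMk, mulPt_two, QPt_of_one]
    simp
    ring

theorem mulPt_line (s t : L) :
    mulPt (K := K) b c ![1, 0, s] ![1, 0, t] = ![1, 0, s + t] := by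
  funext i
  fin_cases i
  · simp [mulPt_zero]
  · simp [mulPt_one]
  · simp only [Fin.reduceFinMk, mulPt_two, QPt_eq_zero (x := ![1, 0, s]) (y := ![1, 0, t]) rfl]
    simp [add_comm]

/-- Dividing out x₁ leaves (1, x₂/x₁^b, x₃/x₁^c). The curve supplies the second coordinate, and the
line corrects the third by what the curve contributed to it. -/
theorem eq_mulPt_mulPt (x : Fin 3 → L) (hx : x 0 ≠ 0) :
    mulPt (K := K) b c ![x 0, 0, 0] (mulPt (K := K) b c
      ![1, x 1 / x 0 ^ b, (x 1 / x 0 ^ b) ^ (c / b + 1)]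
      ![1, 0, x 2 / x 0 ^ c - (x 1 / x 0 ^ b) ^ (c / b + 1)]) = x := by
  have h : mulPt (K := K) b c
      ![1, x 1 / x 0 ^ b, (x 1 / x 0 ^ b) ^ (c / b + 1)]
      ![1, 0, x 2 / x 0 ^ c - (x 1 / x 0 ^ b) ^ (c / b + 1)] =
      ![1, x 1 / x 0 ^ b, x 2 / x 0 ^ c] := by
    funext i
    fin_cases i
    · simp [mulPt_zero]
    · simp [mulPt_one]
    · simp only [Fin.reduceFinMk, mulPt_two, QPt_of_one]
      simp
  rw [h]
  funext i
  fin_cases i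
  · simp [mulPt_zero]
  · simp [mulPt_one]
    field_simp
  · have : QPt (K := K) b c ![x 0, 0, 0] ![1, x 1 / x 0 ^ b, x 2 / x 0 ^ c] = 0 := by
      rw [QPt_comm, QPt_eq_zero rfl]
    simp [mulPt_two, this]
    field_simp

/-- Clears denominators in the formulas forced on the locus x₁ ≠ 0. It is used with A = x₁^b, T =
x₁^c and P = x₁^(b-e), where `pow_denom` provides `h`. -/
theorem mul_add_div_sub_div_pow {A T P : L} {d : ℕ} (hA : A ≠ 0) (hT : T ≠ 0)
    (h : T * P = A ^ (d + 1)) (α β u w : L) :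
    A ^ (d + 1) * (α * (u / A) + β * (w / T - (u / A) ^ (d + 1))) =
      α * u * A ^ d + β * (w * P - u ^ (d + 1)) := by
  have h1 : A ^ (d + 1) * (u / A) = u * A ^ d := by field_simp; ring
  have h2 : A ^ (d + 1) * (w / T) = w * P := by rw [← h]; field_simp
  have h3 : A ^ (d + 1) * (u / A) ^ (d + 1) = u ^ (d + 1) := by
    rw [← mul_pow, mul_div_cancel₀ _ hA]
  linear_combination α * h1 + β * (h2 - h3)

variable [CharZero L] {F : Fin 3 → MvPolynomial (Fin 3) L}

/-- The first component is multiplicative on the monoid. On the two additive curves it is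
exponential, hence 1; on the points (t, 0, 0) it is a power of t. -/
theorem IsPolyHom.exists_zero_eq_pow (h : IsPolyHom K b c F) : ∃ n : ℕ, F 0 = X 0 ^ n := by
  have hm : ∀ x y : Fin 3 → L, eval (mulPt (K := K) b c x y) (F 0) = eval x (F 0) * eval y (F 0) :=
    fun x y => by rw [h.mul, mulPt_zero]
  have h1 : eval ![1, 0, 0] (F 0) = 1 := h.one 0
  have hcurve : ∀ s : L, eval ![1, s, s ^ (c / b + 1)] (F 0) = 1 := by
    obtain ⟨p, hp⟩ := exists_polynomial_eval_eq (F 0) ![1, .X, .X ^ (c / b + 1)]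
    have hp' : ∀ s : L, p.eval s = eval ![1, s, s ^ (c / b + 1)] (F 0) := fun s => by
      rw [hp]; congr 2; funext i; fin_cases i <;> simp
    intro s
    rw [← hp']
    refine eval_eq_one_of_exponential ?_ (fun s t => ?_) s
    · rw [hp']; simpa using h1
    · rw [hp', hp', hp', ← hm, mulPt_curve]
  have hline : ∀ s : L, eval ![1, 0, s] (F 0) = 1 := by
    obtain ⟨p, hp⟩ := exists_polynomial_eval_eq (F 0) ![1, 0, .X]
    have hp' : ∀ s : L, p.eval s = eval ![1, 0, s] (F 0) := fun s => by
      rw [hp]; congr 2; funext i; fin_cases i <;> simp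
    intro s
    rw [← hp']
    refine eval_eq_one_of_exponential ?_ (fun s t => ?_) s
    · rw [hp', h1]
    · rw [hp', hp', hp', ← hm, mulPt_line]
  obtain ⟨p, hp⟩ := exists_polynomial_eval_eq (F 0) ![.X, 0, 0]
  have hp' : ∀ s : L, p.eval s = eval ![s, 0, 0] (F 0) := fun s => by
    rw [hp]; congr 2; funext i; fin_cases i <;> simp
  obtain ⟨n, hn⟩ := exists_eval_eq_pow_of_multiplicative (p := p) (by rw [hp', h1])
    (fun s t => by rw [hp', hp', hp', ← hm, mulPt_torus])
  refine ⟨n, eq_of_eval_eq_of_ne_zero fun x hx => ?_⟩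
  conv_lhs => rw [← eq_mulPt_mulPt (K := K) (b := b) (c := c) x hx, hm, hm, hcurve, hline, ← hp', hn]
  simp

/-- The second component satisfies F(xy) = x₁^b F(y) + y₁^b F(x). It is therefore additive on the
curve and on the line, with slopes α and β, and zero on the points (t, 0, 0); what remains is to
exclude β. -/
theorem IsPolyHom.exists_one_eq (h : IsPolyHom K b c F) (hb : 0 < b) (hbc : b ≤ c)
    (h0 : F 0 = X 0) : ∃ α : L, F 1 = C α * X 1 := by
  have hm : ∀ x y : Fin 3 → L, eval (mulPt (K := K) b c x y) (F 1) =
      x 0 ^ b * eval y (F 1) + y 0 ^ b * eval x (F 1) :=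
    fun x y => by rw [h.mul, mulPt_one, h0, eval_X, eval_X]
  have h1 : eval ![1, 0, 0] (F 1) = 0 := h.one 1
  obtain ⟨α, hα⟩ : ∃ α : L, ∀ s : L, eval ![1, s, s ^ (c / b + 1)] (F 1) = α * s := by
    obtain ⟨p, hp⟩ := exists_polynomial_eval_eq (F 1) ![1, .X, .X ^ (c / b + 1)]
    have hp' : ∀ s : L, p.eval s = eval ![1, s, s ^ (c / b + 1)] (F 1) := fun s => by
      rw [hp]; congr 2; funext i; fin_cases i <;> simp
    refine ⟨p.eval 1, fun s => ?_⟩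
    rw [← hp']
    refine eval_eq_mul_of_additive (fun s t => ?_) s
    rw [hp', hp', hp', ← mulPt_curve (K := K), hm]
    simp [add_comm]
  obtain ⟨β, hβ⟩ : ∃ β : L, ∀ s : L, eval ![1, 0, s] (F 1) = β * s := by
    obtain ⟨p, hp⟩ := exists_polynomial_eval_eq (F 1) ![1, 0, .X]
    have hp' : ∀ s : L, p.eval s = eval ![1, 0, s] (F 1) := fun s => by
      rw [hp]; congr 2; funext i; fin_cases i <;> simp
    refine ⟨p.eval 1, fun s => ?_⟩
    rw [← hp']
    refine eval_eq_mul_of_additive (fun s t => ?_) s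
    rw [hp', hp', hp', ← mulPt_line (K := K) (b := b) (c := c), hm]
    simp [add_comm]
  have htorus : ∀ t : L, eval ![t, 0, 0] (F 1) = 0 := by
    obtain ⟨p, hp⟩ := exists_polynomial_eval_eq (F 1) ![.X, 0, 0]
    have hp' : ∀ s : L, p.eval s = eval ![s, 0, 0] (F 1) := fun s => by
      rw [hp]; congr 2; funext i; fin_cases i <;> simp
    intro t
    -- The rule p(st) = s^b p(t) + t^b p(s) at s = 2 gives p(t) = p(1) t^b, and p(1) = 0.
    rw [← hp', eval_eq_mul_pow_of_eval_two_mul (n := b) (a := p.eval 2), hp', h1, zero_mul]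
    intro t
    rw [hp', hp', ← mulPt_torus (K := K) (b := b) (c := c), hm, ← hp', ← hp']
    simp [mul_comm]
  have key : ∀ x : Fin 3 → L, x 0 ≠ 0 → eval x (F 1) =
      x 0 ^ b * (α * (x 1 / x 0 ^ b) + β * (x 2 / x 0 ^ c - (x 1 / x 0 ^ b) ^ (c / b + 1))) := by
    intro x hx
    conv_lhs => rw [← eq_mulPt_mulPt (K := K) (b := b) (c := c) x hx, hm, hm, htorus, hα, hβ]
    simp [add_comm]
  -- Multiplying by x₁^(bd) turns the formula on x₁ ≠ 0 into a polynomial identity. At (0, 1, 0) it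
  -- reads 0 = -β, because b ≤ c gives d ≥ 1.
  have hβ0 : β = 0 := by
    have hF : (X 0 ^ b) ^ (c / b) * F 1 = C α * X 1 * (X 0 ^ b) ^ (c / b) +
        C β * (X 2 * X 0 ^ (b - c % b) - X 1 ^ (c / b + 1)) := by
      refine eq_of_eval_eq_of_ne_zero fun x hx => ?_
      simp only [map_mul, map_add, map_sub, map_pow, eval_X, eval_C, key x hx]
      rw [← mul_assoc, ← pow_succ, mul_add_div_sub_div_pow (pow_ne_zero _ hx) (pow_ne_zero _ hx)
        (pow_denom b c hb (x 0))]
    have := congrArg (eval ![0, 1, 0]) hF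
    have hd : c / b ≠ 0 := (Nat.div_pos hbc hb).ne'
    simpa [hd, hb.ne'] using this
  refine ⟨α, eq_of_eval_eq_of_ne_zero fun x hx => ?_⟩
  rw [key x hx, hβ0]
  simp
  field_simp

/-- The same method with weight c, where the product rule also carries a Q-term with both second
coordinates scaled by α. Regularity at x₁ = 0 now links the slope δ on the line to α. -/
theorem IsPolyHom.exists_two_eq (h : IsPolyHom K b c F) (hb : 0 < b) (hbc : b ≤ c)
    (h0 : F 0 = X 0) {α : L} (h1 : F 1 = C α * X 1) :
    ∃ γ : L, F 2 = C γ * X 0 ^ (c - b) * X 1 + C (α ^ (c / b + 1)) * X 2 := by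
  have hm : ∀ x y : Fin 3 → L, eval (mulPt (K := K) b c x y) (F 2) =
      x 0 ^ c * eval y (F 2) + y 0 ^ c * eval x (F 2) +
        QPt (K := K) b c ![x 0, α * x 1, eval x (F 2)] ![y 0, α * y 1, eval y (F 2)] := by
    intro x y
    have e : ∀ z : Fin 3 → L, (fun j => eval z (F j)) = ![z 0, α * z 1, eval z (F 2)] := fun z => by
      funext j; fin_cases j <;> simp [h0, h1]
    rw [h.mul, mulPt_two, e, e, h0, eval_X, eval_X]
  have hm' : ∀ x y : Fin 3 → L, y 1 = 0 → eval (mulPt (K := K) b c x y) (F 2) =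
      x 0 ^ c * eval y (F 2) + y 0 ^ c * eval x (F 2) := by
    intro x y hy
    rw [hm, QPt_eq_zero (by simp [hy]), add_zero]
  have hone : eval ![1, 0, 0] (F 2) = 0 := h.one 2
  obtain ⟨γ, hγ⟩ : ∃ γ : L, ∀ s : L, eval ![1, s, s ^ (c / b + 1)] (F 2) =
      γ * s + α ^ (c / b + 1) * s ^ (c / b + 1) := by
    obtain ⟨p, hp⟩ := exists_polynomial_eval_eq (F 2) ![1, .X, .X ^ (c / b + 1)]
    have hp' : ∀ s : L, p.eval s = eval ![1, s, s ^ (c / b + 1)] (F 2) := fun s => by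
      rw [hp]; congr 2; funext i; fin_cases i <;> simp
    -- The failure of p to be additive is the Q-term (αs+αt)^(d+1) - (αs)^(d+1) - (αt)^(d+1), which
    -- the subtracted monomial absorbs.
    let q : Polynomial L := p - .C (α ^ (c / b + 1)) * .X ^ (c / b + 1)
    have hq : ∀ s : L, q.eval s = p.eval s - α ^ (c / b + 1) * s ^ (c / b + 1) := by simp [q]
    refine ⟨q.eval 1, fun s => ?_⟩
    rw [← hp', ← eval_eq_mul_of_additive (p := q) (fun s t => ?_) s, hq]
    · ring
    · rw [hq, hq, hq, hp', hp', hp', ← mulPt_curve (K := K), hm]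
      simp only [Matrix.cons_val_zero, Matrix.cons_val_one, QPt_of_one, ← mul_add, mul_pow]
      ring
  obtain ⟨δ, hδ⟩ : ∃ δ : L, ∀ s : L, eval ![1, 0, s] (F 2) = δ * s := by
    obtain ⟨p, hp⟩ := exists_polynomial_eval_eq (F 2) ![1, 0, .X]
    have hp' : ∀ s : L, p.eval s = eval ![1, 0, s] (F 2) := fun s => by
      rw [hp]; congr 2; funext i; fin_cases i <;> simp
    refine ⟨p.eval 1, fun s => ?_⟩
    rw [← hp']
    refine eval_eq_mul_of_additive (fun s t => ?_) s
    rw [hp', hp', hp', ← mulPt_line (K := K) (b := b) (c := c), hm' _ _ rfl]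
    simp [add_comm]
  have htorus : ∀ t : L, eval ![t, 0, 0] (F 2) = 0 := by
    obtain ⟨p, hp⟩ := exists_polynomial_eval_eq (F 2) ![.X, 0, 0]
    have hp' : ∀ s : L, p.eval s = eval ![s, 0, 0] (F 2) := fun s => by
      rw [hp]; congr 2; funext i; fin_cases i <;> simp
    intro t
    rw [← hp', eval_eq_mul_pow_of_eval_two_mul (n := c) (a := p.eval 2), hp', hone, zero_mul]
    intro t
    rw [hp', hp', ← mulPt_torus (K := K) (b := b) (c := c), hm' _ _ rfl, ← hp', ← hp']
    simp [mul_comm]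
  have key : ∀ x : Fin 3 → L, x 0 ≠ 0 → eval x (F 2) =
      x 0 ^ c * (γ * (x 1 / x 0 ^ b) + α ^ (c / b + 1) * (x 1 / x 0 ^ b) ^ (c / b + 1) +
        δ * (x 2 / x 0 ^ c - (x 1 / x 0 ^ b) ^ (c / b + 1))) := by
    intro x hx
    conv_lhs =>
      rw [← eq_mulPt_mulPt (K := K) (b := b) (c := c) x hx, hm, QPt_comm, QPt_eq_zero (by simp),
        hm' _ _ rfl, htorus, hγ, hδ]
    simp [add_comm]
  -- Multiplying by x₁^(b-e) suffices here. At (0, 1, 0) the identity reads 0 = α^(d+1) - δ, since b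
  -- - e and d are both positive.
  have hδα : δ = α ^ (c / b + 1) := by
    have hF : X 0 ^ (b - c % b) * F 2 = C γ * X 1 * (X 0 ^ b) ^ (c / b) +
        C δ * (X 2 * X 0 ^ (b - c % b) - X 1 ^ (c / b + 1)) +
          C (α ^ (c / b + 1)) * X 1 ^ (c / b + 1) := by
      refine eq_of_eval_eq_of_ne_zero fun x hx => ?_
      have hA := pow_ne_zero b hx
      have hP := pow_denom b c hb (x 0)
      simp only [map_mul, map_add, map_sub, map_pow, eval_X, eval_C, key x hx]
      rw [← mul_add_div_sub_div_pow hA (pow_ne_zero _ hx) hP]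
      have : (x 0 ^ b) ^ (c / b + 1) * (x 1 / x 0 ^ b) ^ (c / b + 1) = x 1 ^ (c / b + 1) := by
        rw [← mul_pow, mul_div_cancel₀ _ hA]
      rw [← this, ← hP]
      ring
    have := congrArg (eval ![0, 1, 0]) hF
    have hd : c / b ≠ 0 := (Nat.div_pos hbc hb).ne'
    have hlt : b - c % b ≠ 0 := Nat.sub_ne_zero_of_lt (Nat.mod_lt c hb)
    simp [hd, hb.ne', hlt] at this
    linear_combination this
  refine ⟨γ, eq_of_eval_eq_of_ne_zero fun x hx => ?_⟩
  obtain ⟨k, rfl⟩ := Nat.exists_eq_add_of_le hbc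
  rw [key x hx, hδα, Nat.add_sub_cancel_left]
  simp
  field_simp
  ring

/-- Invertible polynomial endomorphisms of the monoid `L³`. -/
theorem IsPolyHom.exists_eq_of_comp_eq {F G : Fin 3 → MvPolynomial (Fin 3) L}
    (hF : IsPolyHom K b c F) (hG : IsPolyHom K b c G) (hb : 0 < b) (hbc : b ≤ c)
    (h : ∀ i, aeval F (G i) = X i) :
    ∃ α γ : L, α ≠ 0 ∧ F 0 = X 0 ∧ F 1 = C α * X 1 ∧
      F 2 = C γ * X 0 ^ (c - b) * X 1 + C (α ^ (c / b + 1)) * X 2 := by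
  obtain ⟨n, hn⟩ := hF.exists_zero_eq_pow
  obtain ⟨m, hm⟩ := hG.exists_zero_eq_pow
  -- The first components compose to x₁^(nm), which must be x₁; compare degrees.
  have hnm : n * m = 1 := by
    have h0 := h 0
    rw [hm, map_pow, aeval_X, hn, ← pow_mul] at h0
    have := congrArg totalDegree h0
    simpa using this
  obtain ⟨rfl, rfl⟩ : n = 1 ∧ m = 1 := by simpa using hnm
  rw [pow_one] at hn hm
  obtain ⟨α, hα⟩ := hF.exists_one_eq hb hbc hn
  obtain ⟨α', hα'⟩ := hG.exists_one_eq hb hbc hm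
  obtain ⟨γ, hγ⟩ := hF.exists_two_eq hb hbc hn hα
  refine ⟨α, γ, ?_, hn, hα, hγ⟩
  -- If α = 0 then `F 1` = 0, and substituting it into `G 1`, a multiple of `X 1`, cannot return `X
  -- 1`.
  rintro rfl
  have h1 := h 1
  rw [hα', map_mul, aeval_X, hα] at h1
  simp at h1
  exact X_ne_zero _ h1.symm

theorem QPt_scale_of_ne {B : Type*} [CommRing B] [IsDomain B] [Algebra K B] {x y x' y' : Fin 3 → B}
    {α : B} (hx : x 0 ≠ 0) (hy : y 0 ≠ 0) (hx0 : x' 0 = x 0) (hy0 : y' 0 = y 0)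
    (hx1 : x' 1 = α * x 1) (hy1 : y' 1 = α * y 1) :
    QPt (K := K) b c x' y' = α ^ (c / b + 1) * QPt (K := K) b c x y := by
  have e := denom_mul_QPt (K := K) b c x y
  have e' := denom_mul_QPt (K := K) b c x' y'
  apply mul_left_cancel₀ (pow_ne_zero (b - c % b) (mul_ne_zero hx hy))
  rw [mul_left_comm, e, ← hx0, ← hy0, e', hx1, hy1]
  simp only [mul_left_comm _ α, ← mul_add, mul_pow α, mul_sub]

/-- Q is homogeneous of degree d+1 in (x₂, y₂), which is why α^(d+1) multiplies x₃. The proof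
specialises a generic point as in `QPt_eq_zero`; the third block of variables holds α and the free
third coordinates of x' and y'. -/
theorem QPt_scale {B : Type*} [CommRing B] [Algebra K B] {x y x' y' : Fin 3 → B}
    {α : B} (hx0 : x' 0 = x 0) (hy0 : y' 0 = y 0)
    (hx1 : x' 1 = α * x 1) (hy1 : y' 1 = α * y 1) :
    QPt (K := K) b c x' y' = α ^ (c / b + 1) * QPt (K := K) b c x y := by
  let φ : MvPolynomial (Fin 3 × Fin 3) K →ₐ[K] B := aeval fun p => ![x, y, ![α, x' 2, y' 2]] p.1 p.2
  let f : Fin 3 → MvPolynomial (Fin 3 × Fin 3) K := fun i => X (0, i)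
  let g : Fin 3 → MvPolynomial (Fin 3 × Fin 3) K := fun i => X (1, i)
  let a : MvPolynomial (Fin 3 × Fin 3) K := X (2, 0)
  let f' : Fin 3 → MvPolynomial (Fin 3 × Fin 3) K := ![f 0, a * f 1, X (2, 1)]
  let g' : Fin 3 → MvPolynomial (Fin 3 × Fin 3) K := ![g 0, a * g 1, X (2, 2)]
  have key := congrArg φ (QPt_scale_of_ne (K := K) (b := b) (c := c) (x := f) (y := g)
    (x' := f') (y' := g') (α := a) (X_ne_zero _) (X_ne_zero _) rfl rfl rfl rfl)
  have h0 : (fun j => φ (f j)) = x := by funext j; simp [φ, f]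
  have h1 : (fun j => φ (g j)) = y := by funext j; simp [φ, g]
  have h2 : (fun j => φ (f' j)) = x' := by funext j; fin_cases j <;> simp [φ, f', f, a, hx0, hx1]
  have h3 : (fun j => φ (g' j)) = y' := by funext j; fin_cases j <;> simp [φ, g', g, a, hy0, hy1]
  have ha : φ a = α := by simp [φ, a]
  simpa only [map_QPt, h0, h1, h2, h3, map_mul, map_pow, ha] using key

variable (b c) in
/-- The map `(x₁, x₂, x₃) ↦ (x₁, α x₂, γ x₁^(c-b) x₂ + α^(d+1) x₃)` on points. -/
def matrixAct {B : Type*} [CommRing B] (α γ : B) (x : Fin 3 → B) : Fin 3 → B :=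
  ![x 0, α * x 1, γ * x 0 ^ (c - b) * x 1 + α ^ (c / b + 1) * x 2]

theorem matrixAct_onePt {B : Type*} [CommRing B] (α γ : B) : matrixAct b c α γ onePt = onePt := by
  funext i
  fin_cases i <;> simp [matrixAct, onePt]

/-- The α-part is `QPt_scale`. The γ-part works because x₁^(c-b) x₂ obeys the product rule of weight
c without a Q-term. -/
theorem matrixAct_mulPt {B : Type*} [CommRing B] [Algebra K B] (hbc : b ≤ c) (α γ : B)
    (x y : Fin 3 → B) : matrixAct b c α γ (mulPt (K := K) b c x y) =
      mulPt (K := K) b c (matrixAct b c α γ x) (matrixAct b c α γ y) := by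
  obtain ⟨k, rfl⟩ := Nat.exists_eq_add_of_le hbc
  have hQ := QPt_scale (K := K) (b := b) (c := b + k) (x := x) (y := y)
    (x' := matrixAct b (b + k) α γ x) (y' := matrixAct b (b + k) α γ y) (α := α) rfl rfl rfl rfl
  funext i
  fin_cases i
  · simp [matrixAct, mulPt_zero]
  · simp [matrixAct, mulPt_one]
    ring
  · simp only [Fin.reduceFinMk, mulPt_two, hQ]
    simp [matrixAct, mulPt_zero, mulPt_one, mulPt_two]
    ring

theorem matrixAct_matrixAct {B : Type*} [CommRing B] (α γ α' γ' : B) (x : Fin 3 → B) :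
    matrixAct b c α γ (matrixAct b c α' γ' x) =
      matrixAct b c (α * α') (γ * α' + α ^ (c / b + 1) * γ') x := by
  funext i
  fin_cases i
  · simp [matrixAct]
  · simp [matrixAct, mul_assoc]
  · simp [matrixAct]
    ring

end endomorphisms

end SplitMonoid
end

/-! ### Functions, points and endomorphisms of the scheme M ⊗_K L in coordinates -/

noncomputable section
namespace SplitMonoid
open AlgebraicGeometry CategoryTheory Limits TwistedForms

section functions

variable {T T' : Scheme.{u}} {R S : Type u} [CommRing R] [CommRing S]

/-- The ring homomorphism corresponding to a morphism to an affine scheme. -/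
def ofSpecHom (f : T ⟶ Spec (CommRingCat.of R)) : R →+* Γ(T, ⊤) :=
  f.appTop.hom.comp (Scheme.ΓSpecIso (CommRingCat.of R)).inv.hom

/-- The morphism to an affine scheme corresponding to a ring homomorphism. -/
def toSpecHom (φ : R →+* Γ(T, ⊤)) : T ⟶ Spec (CommRingCat.of R) :=
  T.toSpecΓ ≫ Spec.map (CommRingCat.ofHom φ)

theorem ofSpecHom_toSpecHom (φ : R →+* Γ(T, ⊤)) : ofSpecHom (toSpecHom φ) = φ := by
  have h : (Scheme.ΓSpecIso (CommRingCat.of R)).inv ≫ (toSpecHom φ).appTop =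
      CommRingCat.ofHom φ := by
    rw [toSpecHom, Scheme.Hom.comp_appTop, ← Scheme.ΓSpecIso_inv_naturality_assoc]
    simp
  exact congrArg CommRingCat.Hom.hom h

theorem ofSpecHom_injective {f g : T ⟶ Spec (CommRingCat.of R)} (h : ofSpecHom f = ofSpecHom g) :
    f = g := by
  apply ext_of_isAffine
  rw [← cancel_epi (Scheme.ΓSpecIso (CommRingCat.of R)).inv]
  exact CommRingCat.hom_ext h

theorem ofSpecHom_comp (f : T' ⟶ T) (g : T ⟶ Spec (CommRingCat.of R)) :
    ofSpecHom (f ≫ g) = f.appTop.hom.comp (ofSpecHom g) := by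
  rw [ofSpecHom, Scheme.Hom.comp_appTop]
  rfl

theorem ofSpecHom_comp_map (f : T ⟶ Spec (CommRingCat.of R)) (φ : S →+* R) :
    ofSpecHom (f ≫ Spec.map (CommRingCat.ofHom φ)) = (ofSpecHom f).comp φ := by
  have h : (Scheme.ΓSpecIso (CommRingCat.of S)).inv ≫
      (f ≫ Spec.map (CommRingCat.ofHom φ)).appTop =
      CommRingCat.ofHom φ ≫ (Scheme.ΓSpecIso (CommRingCat.of R)).inv ≫ f.appTop := by
    rw [Scheme.Hom.comp_appTop, ← Scheme.ΓSpecIso_inv_naturality_assoc]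
  exact congrArg CommRingCat.Hom.hom h

end functions

variable (K : Type u) [Field K] (b c : ℕ) (L : Type u) [Field L] [Algebra K L]

/-- The scheme underlying `M ⊗_K L`. -/
abbrev baseScheme : Scheme.{u} := ((baseChange K L).obj (splitMonoid K b c)).X.left

/-- The structure morphism of `M ⊗_K L`. -/
abbrev baseStr : baseScheme K b c L ⟶ Spec (CommRingCat.of L) :=
  ((baseChange K L).obj (splitMonoid K b c)).X.hom

/-- The projection `M ⊗_K L ⟶ M`, as a morphism to an affine scheme. -/
def baseProj : baseScheme K b c L ⟶ Spec (CommRingCat.of (CoordRing K b c)) :=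
  proj (splitMonoid K b c) L

theorem baseProj_comp : baseProj K b c L ≫
    Spec.map (CommRingCat.ofHom (algebraMap K (CoordRing K b c))) =
      baseStr K b c L ≫ specMap K L :=
  proj_hom (splitMonoid K b c)

theorem constFun_eq : constFun K b c L = ofSpecHom (baseStr K b c L) := rfl

theorem ofSpecHom_baseProj_algebraMap (k : K) :
    ofSpecHom (baseProj K b c L) (algebraMap K (CoordRing K b c) k) =
      constFun K b c L (algebraMap K L k) := by
  have := congrArg ofSpecHom (baseProj_comp K b c L)
  rw [ofSpecHom_comp_map, ofSpecHom_comp_map, ← constFun_eq] at this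
  exact RingHom.congr_fun this k

theorem coordRing_ringHom_ext {B : Type*} [CommRing B] {f g : CoordRing K b c →+* B}
    (hc : ∀ k, f (algebraMap K _ k) = g (algebraMap K _ k))
    (h : ∀ i, f (coord K b c i) = g (coord K b c i)) : f = g :=
  MvPolynomial.ringHom_ext (R := K) (σ := Fin 3) hc h

variable {K b c L}

/-- The coordinates determine the projection to the affine scheme M, and the constants determine the
structure morphism to Spec L. Later equalities of morphisms are checked on these functions. -/
theorem basePt_ext {T : Scheme.{u}} {p q : T ⟶ baseScheme K b c L}
    (hc : ∀ l, p.appTop.hom (constFun K b c L l) = q.appTop.hom (constFun K b c L l))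
    (h : ∀ i, p.appTop.hom (coordFun K b c L i) = q.appTop.hom (coordFun K b c L i)) :
    p = q := by
  apply baseChange_hom_ext
  · refine ofSpecHom_injective (f := p ≫ baseProj K b c L) (g := q ≫ baseProj K b c L) ?_
    rw [ofSpecHom_comp, ofSpecHom_comp]
    refine coordRing_ringHom_ext K b c (fun k => ?_) h
    simp only [RingHom.comp_apply, ofSpecHom_baseProj_algebraMap, hc]
  · apply ofSpecHom_injective
    rw [ofSpecHom_comp, ofSpecHom_comp]
    exact RingHom.ext hc

/-- The point of `M ⊗_K L` with given coordinates. -/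
def basePt {T : Scheme.{u}} (φ : L →+* Γ(T, ⊤)) (x : Fin 3 → Γ(T, ⊤)) :
    T ⟶ baseScheme K b c L :=
  letI := (φ.comp (algebraMap K L)).toAlgebra
  have h : toSpecHom (evalPt K b c x : CoordRing K b c →+* Γ(T, ⊤)) ≫
      Spec.map (CommRingCat.ofHom (algebraMap K (CoordRing K b c))) =
        toSpecHom φ ≫ specMap K L := by
    apply ofSpecHom_injective
    rw [ofSpecHom_comp_map, ofSpecHom_comp_map, ofSpecHom_toSpecHom, ofSpecHom_toSpecHom]
    exact (evalPt K b c x).comp_algebraMap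
  pullback.lift (toSpecHom (evalPt K b c x : CoordRing K b c →+* Γ(T, ⊤))) (toSpecHom φ) h

theorem basePt_constFun {T : Scheme.{u}} (φ : L →+* Γ(T, ⊤)) (x : Fin 3 → Γ(T, ⊤)) (l : L) :
    (basePt (K := K) (b := b) (c := c) φ x).appTop.hom (constFun K b c L l) = φ l := by
  have h : basePt (K := K) (b := b) (c := c) φ x ≫ baseStr K b c L = toSpecHom φ :=
    pullback.lift_snd _ _ _
  have := congrArg ofSpecHom h
  rw [ofSpecHom_toSpecHom, ofSpecHom_comp] at this
  exact RingHom.congr_fun this l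

theorem basePt_coordFun {T : Scheme.{u}} (φ : L →+* Γ(T, ⊤)) (x : Fin 3 → Γ(T, ⊤)) (i : Fin 3) :
    (basePt (K := K) (b := b) (c := c) φ x).appTop.hom (coordFun K b c L i) = x i := by
  let := (φ.comp (algebraMap K L)).toAlgebra
  have h : basePt (K := K) (b := b) (c := c) φ x ≫ baseProj K b c L =
      toSpecHom (evalPt K b c x : CoordRing K b c →+* Γ(T, ⊤)) :=
    pullback.lift_fst _ _ _
  have := congrArg ofSpecHom h
  rw [ofSpecHom_toSpecHom, ofSpecHom_comp] at this
  exact (RingHom.congr_fun this (coord K b c i)).trans (evalPt_coord x i)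

variable (K b c L) in
/-- The homomorphism from polynomials to functions on `M ⊗_K L`. -/
def polyFun : MvPolynomial (Fin 3) L →+* Γ(baseScheme K b c L, ⊤) :=
  eval₂Hom (constFun K b c L) (coordFun K b c L)

theorem polyFun_C (l : L) : polyFun K b c L (C l) = constFun K b c L l := by simp [polyFun]

theorem polyFun_X (i : Fin 3) : polyFun K b c L (X i) = coordFun K b c L i := by simp [polyFun]

/-- M ⊗_K L is compared with P = Spec L[x₁, x₂, x₃]. The point `p` pulls `polyFun` back to the
canonical isomorphism `ι`, giving injectivity; `q ≫ p = 𝟙` gives surjectivity. -/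
theorem polyFun_bijective : Function.Bijective (polyFun K b c L) := by
  let P := Spec (CommRingCat.of (MvPolynomial (Fin 3) L))
  let ι : MvPolynomial (Fin 3) L →+* Γ(P, ⊤) := (Scheme.ΓSpecIso (CommRingCat.of _)).inv.hom
  let p : P ⟶ baseScheme K b c L := basePt (ι.comp C) (fun i => ι (X i))
  let q : baseScheme K b c L ⟶ P := toSpecHom (polyFun K b c L)
  have hι : p.appTop.hom.comp (polyFun K b c L) = ι := by
    refine MvPolynomial.ringHom_ext (fun l => ?_) (fun i => ?_)
    · rw [RingHom.comp_apply, polyFun_C, basePt_constFun]; rfl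
    · rw [RingHom.comp_apply, polyFun_X, basePt_coordFun]
  have hq : ∀ x, q.appTop.hom (ι x) = polyFun K b c L x :=
    RingHom.congr_fun (ofSpecHom_toSpecHom _)
  replace hι : ∀ x, p.appTop.hom (polyFun K b c L x) = ι x := RingHom.congr_fun hι
  have hqp : q ≫ p = 𝟙 _ := by
    refine basePt_ext (fun l => ?_) (fun i => ?_)
    · simp only [Scheme.Hom.comp_appTop, CommRingCat.hom_comp, RingHom.comp_apply]
      rw [← polyFun_C, hι, hq]
      simp
    · simp only [Scheme.Hom.comp_appTop, CommRingCat.hom_comp, RingHom.comp_apply]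
      rw [← polyFun_X, hι, hq]
      simp
  have hιb : Function.Bijective ι :=
    ConcreteCategory.bijective_of_isIso (Scheme.ΓSpecIso (CommRingCat.of _)).inv
  refine ⟨fun x y hxy => hιb.1 ?_, fun x => ?_⟩
  · rw [← hι, ← hι, hxy]
  · obtain ⟨y, hy⟩ := hιb.2 (p.appTop.hom x)
    refine ⟨y, ?_⟩
    rw [← hq, hy, ← RingHom.comp_apply, ← CommRingCat.hom_comp,
      ← Scheme.Hom.comp_appTop, hqp]
    simp

variable (K b c) in
/-- The product on points with values in a ring with a homomorphism from `K`. -/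
def mulPtHom {B : Type*} [CommRing B] (ψ : K →+* B) (x y : Fin 3 → B) : Fin 3 → B :=
  letI := ψ.toAlgebra
  mulPt (K := K) b c x y

theorem mulPtHom_algebraMap {B : Type*} [CommRing B] [Algebra K B] (x y : Fin 3 → B) :
    mulPtHom K b c (algebraMap K B) x y = mulPt (K := K) b c x y := by
  have : (algebraMap K B).toAlgebra = ‹Algebra K B› := Algebra.algebra_ext _ _ fun _ => rfl
  rw [mulPtHom, this]

/-- The structure map from K is carried along explicitly because rings of sections receive theirs
from varying morphisms. -/
theorem map_mulPtHom {B B' : Type*} [CommRing B] [CommRing B'] (ψ : K →+* B) (h : B →+* B')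
    (x y : Fin 3 → B) (i : Fin 3) : h (mulPtHom K b c ψ x y i) =
      mulPtHom K b c (h.comp ψ) (fun j => h (x j)) (fun j => h (y j)) i := by
  let := ψ.toAlgebra
  let := (h.comp ψ).toAlgebra
  exact map_mulPt b c (⟨h, fun _ => rfl⟩ : B →ₐ[K] B') x y i

theorem mulMorBase_splitMonoid : mulMorBase (splitMonoid K b c) =
    (pullbackSpecIso K (CoordRing K b c) (CoordRing K b c)).hom ≫
      (Spec.map (CommRingCat.ofHom (comulHom K b c).toRingHom) :
        Spec (CommRingCat.of (CoordRing K b c ⊗[K] CoordRing K b c)) ⟶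
          Spec (CommRingCat.of (CoordRing K b c))) := rfl

theorem oneMorBase_splitMonoid : oneMorBase (splitMonoid K b c) =
      (Spec.map (CommRingCat.ofHom (counitHom K b c).toRingHom) :
        Spec (CommRingCat.of K) ⟶ Spec (CommRingCat.of (CoordRing K b c))) := rfl

/-- Composing `r` with the projection to M × M gives a T-point of Spec (A ⊗ A), and multiplication
there is the comultiplication on coordinates. The two inclusions of A recover the coordinates of the
two factors. -/
theorem mulMor_coordFun {T : Scheme.{u}}
    (r : T ⟶ pullback (baseStr K b c L) (baseStr K b c L)) (i : Fin 3) :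
    (r ≫ mulMor (splitMonoid K b c) L).appTop.hom (coordFun K b c L i) =
      mulPtHom K b c ((ofSpecHom (r ≫ pullback.fst _ _ ≫ baseStr K b c L)).comp (algebraMap K L))
        (fun j => (r ≫ pullback.fst _ _).appTop.hom (coordFun K b c L j))
        (fun j => (r ≫ pullback.snd _ _).appTop.hom (coordFun K b c L j)) i := by
  let A := CoordRing K b c
  let π := prodMap _ _ (proj (splitMonoid K b c) L) (specMap K L) (proj_hom (splitMonoid K b c))
  let s : T ⟶ Spec (CommRingCat.of (A ⊗[K] A)) := r ≫ π ≫ (pullbackSpecIso K A A).hom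
  have h : (r ≫ mulMor (splitMonoid K b c) L) ≫ baseProj K b c L =
      s ≫ Spec.map (CommRingCat.ofHom (comulHom K b c).toRingHom) := by
    refine (Category.assoc _ _ _).trans ((congrArg (r ≫ ·) (mulMor_proj _)).trans ?_)
    rw [mulMorBase_splitMonoid]
    simp only [s, Category.assoc]
    rfl
  have hl : s ≫ Spec.map (CommRingCat.ofHom (Algebra.TensorProduct.includeLeftRingHom)) =
      (r ≫ pullback.fst _ _) ≫ baseProj K b c L := by
    refine (Category.assoc _ _ _).trans (.trans ?_ (Category.assoc _ _ _).symm)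
    refine congrArg (r ≫ ·) ((Category.assoc _ _ _).trans ?_)
    exact (congrArg (π ≫ ·) (pullbackSpecIso_hom_fst K A A)).trans (prodMap_fst _ _ _ _ _)
  have hr : s ≫ Spec.map (CommRingCat.ofHom
      (Algebra.TensorProduct.includeRight : A →ₐ[K] A ⊗[K] A).toRingHom) =
      (r ≫ pullback.snd _ _) ≫ baseProj K b c L := by
    refine (Category.assoc _ _ _).trans (.trans ?_ (Category.assoc _ _ _).symm)
    refine congrArg (r ≫ ·) ((Category.assoc _ _ _).trans ?_)
    exact (congrArg (π ≫ ·) (pullbackSpecIso_hom_snd K A A)).trans (prodMap_snd _ _ _ _ _)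
  replace h := RingHom.congr_fun (congrArg ofSpecHom h) (coord K b c i)
  replace hl := RingHom.congr_fun (congrArg ofSpecHom hl)
  replace hr := RingHom.congr_fun (congrArg ofSpecHom hr)
  rw [ofSpecHom_comp_map, ofSpecHom_comp] at h
  rw [ofSpecHom_comp_map, ofSpecHom_comp (r ≫ pullback.fst _ _) (baseProj K b c L)] at hl
  rw [ofSpecHom_comp_map, ofSpecHom_comp (r ≫ pullback.snd _ _) (baseProj K b c L)] at hr
  have hc : (ofSpecHom s).comp (algebraMap K _) =
      (ofSpecHom (r ≫ pullback.fst _ _ ≫ baseStr K b c L)).comp (algebraMap K L) := by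
    ext k
    rw [← Category.assoc, ofSpecHom_comp]
    refine (hl (algebraMap K A k)).trans ?_
    rw [RingHom.comp_apply, ofSpecHom_baseProj_algebraMap]
    rfl
  refine h.trans ?_
  have e : (comulHom K b c).toRingHom (coord K b c i) = mulPtHom K b c (algebraMap K (A ⊗[K] A))
      (fun i => coord K b c i ⊗ₜ[K] 1) (fun i => 1 ⊗ₜ[K] coord K b c i) i := by
    rw [mulPtHom_algebraMap]
    exact evalPt_coord _ _
  rw [RingHom.comp_apply, e, map_mulPtHom, hc]
  congr 1
  · funext j; exact hl (coord K b c j)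
  · funext j; exact hr (coord K b c j)

theorem oneMor_coordFun (i : Fin 3) :
    (oneMor (splitMonoid K b c) L).appTop.hom (coordFun K b c L i) = onePt i := by
  have h : oneMor (splitMonoid K b c) L ≫ baseProj K b c L =
      specMap K L ≫ Spec.map (CommRingCat.ofHom (counitHom K b c).toRingHom) :=
    (oneMor_proj _).trans (congrArg _ oneMorBase_splitMonoid)
  replace h := RingHom.congr_fun (congrArg ofSpecHom h) (coord K b c i)
  rw [ofSpecHom_comp_map, ofSpecHom_comp] at h
  refine h.trans ?_
  have e : (counitHom K b c).toRingHom (coord K b c i) = onePt i := evalPt_coord _ _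
  rw [RingHom.comp_apply, e]
  fin_cases i <;> simp [onePt]

variable (L) in
/-- The constant functions on `Spec L`. -/
def specConst : L →+* Γ(Spec (CommRingCat.of L), ⊤) := ofSpecHom (𝟙 _)

theorem oneMor_constFun (l : L) :
    (oneMor (splitMonoid K b c) L).appTop.hom (constFun K b c L l) = specConst L l := by
  have h := RingHom.congr_fun (congrArg ofSpecHom (oneMor_hom (M := splitMonoid K b c) (L := L))) l
  rw [ofSpecHom_comp] at h
  exact h

theorem onePt_map {B B' : Type*} [CommRing B] [CommRing B'] (h : B →+* B') (i : Fin 3) :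
    h (onePt i) = onePt i := by
  fin_cases i <;> simp [onePt]

variable (K b c) in
/-- The endomorphism `(x₁, x₂, x₃) ↦ (x₁, α x₂, γ x₁^(c-b) x₂ + α^(d+1) x₃)` of the scheme
`M ⊗_K L`. -/
def matrixMor (α γ : L) : baseScheme K b c L ⟶ baseScheme K b c L :=
  basePt (constFun K b c L)
    (matrixAct b c (constFun K b c L α) (constFun K b c L γ) (coordFun K b c L))

theorem matrixMor_constFun (α γ l : L) :
    (matrixMor K b c α γ).appTop.hom (constFun K b c L l) = constFun K b c L l :=
  basePt_constFun _ _ _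

theorem matrixMor_coordFun (α γ : L) (i : Fin 3) :
    (matrixMor K b c α γ).appTop.hom (coordFun K b c L i) =
      matrixAct b c (constFun K b c L α) (constFun K b c L γ) (coordFun K b c L) i :=
  basePt_coordFun _ _ _

theorem map_matrixAct {B B' : Type*} [CommRing B] [CommRing B'] (h : B →+* B') (α γ : B)
    (x : Fin 3 → B) (i : Fin 3) :
    h (matrixAct b c α γ x i) = matrixAct b c (h α) (h γ) (fun j => h (x j)) i := by
  fin_cases i <;> simp [matrixAct]

theorem matrixAct_mulPtHom {B : Type*} [CommRing B] (hbc : b ≤ c) (ψ : K →+* B) (α γ : B)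
    (x y : Fin 3 → B) : matrixAct b c α γ (mulPtHom K b c ψ x y) =
      mulPtHom K b c ψ (matrixAct b c α γ x) (matrixAct b c α γ y) :=
  let := ψ.toAlgebra
  matrixAct_mulPt hbc α γ x y

theorem appTop_comp_apply {X Y Z : Scheme.{u}} (f : X ⟶ Y) (g : Y ⟶ Z) (x : Γ(Z, ⊤)) :
    (f ≫ g).appTop.hom x = f.appTop.hom (g.appTop.hom x) := by
  rw [Scheme.Hom.comp_appTop]
  rfl

theorem matrixMor_baseStr (α γ : L) : matrixMor K b c α γ ≫ baseStr K b c L = baseStr K b c L :=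
  ofSpecHom_injective (by
    rw [ofSpecHom_comp]
    exact RingHom.ext (matrixMor_constFun α γ))

theorem appTop_constFun {T : Scheme.{u}} (p : T ⟶ baseScheme K b c L) (l : L) :
    p.appTop.hom (constFun K b c L l) = ofSpecHom (p ≫ baseStr K b c L) l := by
  rw [ofSpecHom_comp]
  rfl

/-- On coordinate functions the two conditions become `matrixAct_onePt` and `matrixAct_mulPtHom`,
the latter applied to the universal pair of points on the fibre product. -/
theorem isMonoidHom_matrixMor (hbc : b ≤ c) (α γ : L) :
    IsMonoidHom (splitMonoid K b c) (matrixMor K b c α γ) := by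
  refine ⟨matrixMor_baseStr α γ, basePt_ext (fun l => ?_) (fun i => ?_),
    basePt_ext (fun l => ?_) (fun i => ?_)⟩
  · rw [appTop_comp_apply, matrixMor_constFun]
  · rw [appTop_comp_apply, matrixMor_coordFun, map_matrixAct, oneMor_coordFun]
    simp only [oneMor_coordFun]
    exact congrFun (matrixAct_onePt _ _) i
  · rw [appTop_comp_apply, matrixMor_constFun, appTop_constFun, appTop_constFun, Category.assoc,
      mulMor_hom]
    have := prodMap_fst _ _ (matrixMor K b c α γ) (𝟙 _)
      ((matrixMor_baseStr α γ).trans (Category.comp_id _).symm)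
    rw [← Category.assoc, this, Category.assoc, matrixMor_baseStr]
  · set r := prodMap _ _ (matrixMor K b c α γ) (𝟙 _)
      ((matrixMor_baseStr α γ).trans (Category.comp_id _).symm)
    have h1 : r ≫ pullback.fst _ _ = pullback.fst _ _ ≫ matrixMor K b c α γ := prodMap_fst _ _ _ _ _
    have h2 : r ≫ pullback.snd _ _ = pullback.snd _ _ ≫ matrixMor K b c α γ := prodMap_snd _ _ _ _ _
    have h3 := mulMor_coordFun (𝟙 (pullback (baseStr K b c L) (baseStr K b c L)))
    simp only [Category.id_comp] at h3
    have hm : ∀ l, (mulMor (splitMonoid K b c) L).appTop.hom (constFun K b c L l) =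
        (pullback.fst (baseStr K b c L) (baseStr K b c L)).appTop.hom (constFun K b c L l) := by
      intro l
      rw [appTop_constFun, appTop_constFun, mulMor_hom]
    have hs : ∀ l, (pullback.snd (baseStr K b c L) (baseStr K b c L)).appTop.hom
          (constFun K b c L l) =
        (pullback.fst (baseStr K b c L) (baseStr K b c L)).appTop.hom (constFun K b c L l) := by
      intro l
      rw [appTop_constFun, appTop_constFun, pullback.condition]
    have hψ : r ≫ pullback.fst _ _ ≫ baseStr K b c L = pullback.fst _ _ ≫ baseStr K b c L := by
      rw [← Category.assoc, h1, Category.assoc, matrixMor_baseStr]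
    rw [mulMor_coordFun r, h1, h2, hψ, appTop_comp_apply, matrixMor_coordFun, map_matrixAct]
    simp only [h3, hm, appTop_comp_apply, matrixMor_coordFun, map_matrixAct, hs]
    exact congrFun (matrixAct_mulPtHom hbc _ _ _ _ _) i

theorem matrixMor_comp (α γ α' γ' : L) :
    matrixMor K b c α' γ' ≫ matrixMor K b c α γ =
      matrixMor K b c (α * α') (γ * α' + α ^ (c / b + 1) * γ') := by
  refine basePt_ext (fun l => ?_) (fun i => ?_)
  · rw [appTop_comp_apply, matrixMor_constFun, matrixMor_constFun, matrixMor_constFun]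
  · rw [appTop_comp_apply, matrixMor_coordFun, map_matrixAct, matrixMor_coordFun]
    simp only [matrixMor_coordFun, matrixMor_constFun]
    refine (congrFun (matrixAct_matrixAct _ _ _ _ _) i).trans ?_
    simp only [map_mul, map_add, map_pow]

theorem matrixMor_one_zero : matrixMor K b c (1 : L) 0 = 𝟙 _ := by
  refine basePt_ext (fun l => ?_) (fun i => ?_)
  · rw [matrixMor_constFun]
    simp
  · rw [matrixMor_coordFun]
    fin_cases i <;> simp [matrixAct]

theorem matrixAct_coordFun_eq_polyFun (α γ : L) (i : Fin 3) :
    matrixAct b c (constFun K b c L α) (constFun K b c L γ) (coordFun K b c L) i =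
      polyFun K b c L (![X 0, C α * X 1, C γ * X 0 ^ (c - b) * X 1 +
        C (α ^ (c / b + 1)) * X 2] i) := by
  fin_cases i <;> simp [matrixAct, polyFun]

theorem matrixMor_injective {α γ α' γ' : L} (h : matrixMor K b c α γ = matrixMor K b c α' γ') :
    α = α' ∧ γ = γ' := by
  have key : ∀ i, (![X 0, C α * X 1, C γ * X 0 ^ (c - b) * X 1 +
        C (α ^ (c / b + 1)) * X 2] : Fin 3 → MvPolynomial (Fin 3) L) i = ![X 0, C α' * X 1,
        C γ' * X 0 ^ (c - b) * X 1 + C (α' ^ (c / b + 1)) * X 2] i := fun i =>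
    (polyFun_bijective (K := K) (b := b) (c := c)).1 (by
      rw [← matrixAct_coordFun_eq_polyFun, ← matrixAct_coordFun_eq_polyFun, ← matrixMor_coordFun,
        ← matrixMor_coordFun, h])
  -- At (1, 1, 0) the second polynomial takes the value α and the third the value γ.
  have h1 := congrArg (eval ![1, 1, 0]) (key 1)
  have h2 := congrArg (eval ![1, 1, 0]) (key 2)
  exact ⟨by simpa using h1, by simpa using h2⟩

/-- The `L`-point of `M ⊗_K L` with given coordinates. -/
def fieldPt (x : Fin 3 → L) : Spec (CommRingCat.of L) ⟶ baseScheme K b c L :=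
  basePt (specConst L) (fun i => specConst L (x i))

theorem fieldPt_constFun (x : Fin 3 → L) (l : L) :
    (fieldPt (K := K) (b := b) (c := c) x).appTop.hom (constFun K b c L l) = specConst L l :=
  basePt_constFun _ _ _

theorem fieldPt_coordFun (x : Fin 3 → L) (i : Fin 3) :
    (fieldPt (K := K) (b := b) (c := c) x).appTop.hom (coordFun K b c L i) = specConst L (x i) :=
  basePt_coordFun _ _ _

theorem fieldPt_polyFun (x : Fin 3 → L) (P : MvPolynomial (Fin 3) L) :
    (fieldPt (K := K) (b := b) (c := c) x).appTop.hom (polyFun K b c L P) =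
      specConst L (eval x P) := by
  have : (fieldPt (K := K) (b := b) (c := c) x).appTop.hom.comp (polyFun K b c L) =
      (specConst L).comp (eval x) := by
    refine MvPolynomial.ringHom_ext (fun l => ?_) (fun i => ?_)
    · rw [RingHom.comp_apply, RingHom.comp_apply, polyFun_C, fieldPt_constFun, eval_C]
    · rw [RingHom.comp_apply, RingHom.comp_apply, polyFun_X, fieldPt_coordFun, eval_X]
  exact RingHom.congr_fun this P

theorem fieldPt_baseStr (x : Fin 3 → L) :
    fieldPt (K := K) (b := b) (c := c) x ≫ baseStr K b c L = 𝟙 _ := by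
  apply ofSpecHom_injective
  rw [ofSpecHom_comp]
  exact RingHom.ext fun l => fieldPt_constFun x l

theorem specConst_injective : Function.Injective (specConst L) := by
  have : specConst L = (Scheme.ΓSpecIso (CommRingCat.of L)).inv.hom := by
    simp [specConst, ofSpecHom]
  rw [this]
  exact (ConcreteCategory.bijective_of_isIso (Scheme.ΓSpecIso (CommRingCat.of L)).inv).1

theorem fieldPt_mul
    (r : Spec (CommRingCat.of L) ⟶ pullback (baseStr K b c L) (baseStr K b c L))
    {x y : Fin 3 → L} (hx : r ≫ pullback.fst _ _ = fieldPt x)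
    (hy : r ≫ pullback.snd _ _ = fieldPt y) :
    r ≫ mulMor (splitMonoid K b c) L = fieldPt (mulPt (K := K) b c x y) := by
  refine basePt_ext (fun l => ?_) (fun i => ?_)
  · rw [appTop_constFun, appTop_constFun, Category.assoc, mulMor_hom, ← Category.assoc, hx,
      fieldPt_baseStr, fieldPt_baseStr]
  · rw [mulMor_coordFun, ← Category.assoc, hx, hy, fieldPt_baseStr]
    simp only [fieldPt_coordFun]
    rw [← mulPtHom_algebraMap, map_mulPtHom]
    rfl

/-- Only L-points are needed: `f` sends the point x to the point with coordinates F(x), and an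
L-point determines its coordinates. -/
theorem isPolyHom_of_isMonoidHom {f : baseScheme K b c L ⟶ baseScheme K b c L}
    (hf : IsMonoidHom (splitMonoid K b c) f) {F : Fin 3 → MvPolynomial (Fin 3) L}
    (hF : ∀ i, f.appTop.hom (coordFun K b c L i) = polyFun K b c L (F i)) :
    IsPolyHom K b c F := by
  have hone : oneMor (splitMonoid K b c) L = fieldPt (onePt : Fin 3 → L) := by
    refine basePt_ext (fun l => ?_) (fun i => ?_)
    · rw [oneMor_constFun, fieldPt_constFun]
    · rw [oneMor_coordFun, fieldPt_coordFun, onePt_map]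
  have hpt : ∀ x : Fin 3 → L, fieldPt x ≫ f =
      fieldPt (K := K) (b := b) (c := c) (fun i => eval x (F i)) := by
    intro x
    refine basePt_ext (fun l => ?_) (fun i => ?_)
    · rw [appTop_constFun, appTop_constFun, Category.assoc, hf.isOver, fieldPt_baseStr,
        fieldPt_baseStr]
    · rw [appTop_comp_apply, hF, fieldPt_polyFun, fieldPt_coordFun]
  have hinj : ∀ x y : Fin 3 → L, fieldPt (K := K) (b := b) (c := c) x = fieldPt y → x = y := by
    intro x y h
    funext i
    apply specConst_injective
    rw [← fieldPt_coordFun (K := K) (b := b) (c := c), h, fieldPt_coordFun]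
  refine ⟨congrFun (hinj _ _ ?_), fun x y => congrFun (hinj _ _ ?_)⟩
  · rw [← hpt, ← hone, hf.one]
  · let r : Spec (CommRingCat.of L) ⟶ pullback (baseStr K b c L) (baseStr K b c L) :=
      pullback.lift (fieldPt x) (fieldPt y) (by rw [fieldPt_baseStr, fieldPt_baseStr])
    have hr1 : r ≫ pullback.fst _ _ = fieldPt x := pullback.lift_fst _ _ _
    have hr2 : r ≫ pullback.snd _ _ = fieldPt y := pullback.lift_snd _ _ _
    rw [← hpt, ← fieldPt_mul r hr1 hr2, Category.assoc, hf.mul, ← Category.assoc]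
    refine fieldPt_mul _ ?_ ?_
    · rw [Category.assoc, prodMap_fst, ← Category.assoc, hr1, hpt]
    · rw [Category.assoc, prodMap_snd, ← Category.assoc, hr2, hpt]

/-- By `polyFun_bijective` the automorphism and its inverse are given by polynomial triples `F` and
`G`, with pullback acting by substitution. The classification of invertible polynomial endomorphisms
then applies. -/
theorem exists_eq_matrixMor [CharZero L] (hb : 0 < b) (hbc : b ≤ c)
    (f : AutOver L (splitMonoid K b c)) :
    ∃ α γ : L, α ≠ 0 ∧ f.hom.hom.left = matrixMor K b c α γ := by
  choose F hF using fun i => (polyFun_bijective (K := K) (b := b) (c := c) (L := L)).2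
    (f.hom.hom.left.appTop.hom (coordFun K b c L i))
  choose G hG using fun i => (polyFun_bijective (K := K) (b := b) (c := c) (L := L)).2
    (f.inv.hom.left.appTop.hom (coordFun K b c L i))
  have hf := isMonoidHom_left f.hom
  have hg := isMonoidHom_left f.inv
  have hcF : ∀ P, f.hom.hom.left.appTop.hom (polyFun K b c L P) = polyFun K b c L (aeval F P) := by
    have : f.hom.hom.left.appTop.hom.comp (polyFun K b c L) =
        (polyFun K b c L).comp (aeval F : MvPolynomial (Fin 3) L →ₐ[L] _).toRingHom := by
      refine MvPolynomial.ringHom_ext (fun l => ?_) (fun i => ?_)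
      · rw [RingHom.comp_apply, polyFun_C, appTop_constFun, hf.isOver]
        simp [polyFun_C, constFun_eq]
      · rw [RingHom.comp_apply, polyFun_X, ← hF]
        simp
    exact RingHom.congr_fun this
  obtain ⟨α, γ, hα, h0, h1, h2⟩ := (isPolyHom_of_isMonoidHom hf fun i => (hF i).symm).exists_eq_of_comp_eq
    (isPolyHom_of_isMonoidHom hg fun i => (hG i).symm) hb hbc (fun i => by
      apply (polyFun_bijective (K := K) (b := b) (c := c) (L := L)).1
      rw [← hcF, hG, ← appTop_comp_apply, hom_inv_left, polyFun_X]
      simp)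
  refine ⟨α, γ, hα, basePt_ext (fun l => ?_) (fun i => ?_)⟩
  · rw [appTop_constFun, hf.isOver, matrixMor_constFun]
    rfl
  · rw [matrixMor_coordFun, matrixAct_coordFun_eq_polyFun, ← hF]
    fin_cases i
    · simp [h0]
    · simp [h1]
    · simp [h2]

end SplitMonoid
end

/-! ### The automorphism group as a matrix group -/

noncomputable section
namespace SplitMonoid
open AlgebraicGeometry CategoryTheory Limits TwistedForms

section automorphisms

variable {K : Type u} [Field K] {b c : ℕ} {L : Type u} [Field L] [Algebra K L]

theorem matrixGroup_ne_zero {d : ℕ} (g : matrixGroup L d) : g.1 0 0 ≠ 0 := by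
  intro h
  have hd : (g.1 : Matrix (Fin 2) (Fin 2) L).det ≠ 0 :=
    ((Matrix.isUnit_iff_isUnit_det _).mp g.1.isUnit).ne_zero
  rw [Matrix.det_fin_two, h, g.2.1] at hd
  simp at hd

theorem matrixGroup_mul_zero_zero {d : ℕ} (g h : matrixGroup L d) :
    (g * h).1 0 0 = g.1 0 0 * h.1 0 0 := by
  simp [Matrix.mul_apply, Fin.sum_univ_two, g.2.1]

theorem matrixGroup_mul_one_zero {d : ℕ} (g h : matrixGroup L d) :
    (g * h).1 1 0 = g.1 1 0 * h.1 0 0 + g.1 0 0 ^ (d + 1) * h.1 1 0 := by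
  simp [Matrix.mul_apply, Fin.sum_univ_two, ← g.2.2]

/-- The matrix with given entries `α` and `γ`. -/
def mkMatrix (d : ℕ) (α γ : L) (hα : α ≠ 0) : matrixGroup L d :=
  ⟨Matrix.GeneralLinearGroup.mkOfDetNeZero !![α, 0; γ, α ^ (d + 1)] (by
    simp [Matrix.det_fin_two, hα]), by
    constructor <;> simp [Matrix.GeneralLinearGroup.mkOfDetNeZero]⟩

theorem matrixGroup_ext {d : ℕ} {g h : matrixGroup L d} (h0 : g.1 0 0 = h.1 0 0)
    (h1 : g.1 1 0 = h.1 1 0) : g = h := by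
  apply Subtype.ext
  apply Units.ext
  ext i j
  fin_cases i <;> fin_cases j
  · exact h0
  · exact g.2.1.trans h.2.1.symm
  · exact h1
  · exact g.2.2.trans ((congrArg (· ^ (d + 1)) h0).trans h.2.2.symm)

variable (K) in
/-- The endomorphism of the scheme `M ⊗_K L` given by a matrix. -/
def matrixHom (g : matrixGroup L (c / b)) : baseScheme K b c L ⟶ baseScheme K b c L :=
  matrixMor K b c (g.1 0 0) (g.1 1 0)

/-- The factors are reversed because `≫` is diagrammatic; the product in `AutOver` reverses them
again. -/
theorem matrixHom_comp (g h : matrixGroup L (c / b)) :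
    matrixHom K (b := b) (c := c) g ≫ matrixHom K h = matrixHom K (h * g) := by
  rw [matrixHom, matrixHom, matrixMor_comp, matrixHom, matrixGroup_mul_zero_zero,
    matrixGroup_mul_one_zero]

theorem matrixHom_one : matrixHom K (b := b) (c := c) (1 : matrixGroup L (c / b)) = 𝟙 _ := by
  rw [← matrixMor_one_zero, matrixHom]
  congr 1

variable (K) in
/-- The automorphism of the monoid scheme `M ⊗_K L` given by a matrix. -/
def matrixAut (hbc : b ≤ c) (g : matrixGroup L (c / b)) : AutOver L (splitMonoid K b c) where
  hom := (isMonoidHom_matrixMor hbc (g.1 0 0) (g.1 1 0)).toHom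
  inv := (isMonoidHom_matrixMor hbc (g⁻¹.1 0 0) (g⁻¹.1 1 0)).toHom
  hom_inv_id := by
    apply Mon.Hom.ext
    apply Over.OverMorphism.ext
    exact (matrixHom_comp g g⁻¹).trans (by rw [inv_mul_cancel, matrixHom_one]; rfl)
  inv_hom_id := by
    apply Mon.Hom.ext
    apply Over.OverMorphism.ext
    exact (matrixHom_comp g⁻¹ g).trans (by rw [mul_inv_cancel, matrixHom_one]; rfl)

theorem matrixAut_left (hbc : b ≤ c) (g : matrixGroup L (c / b)) :
    (matrixAut K hbc g).hom.hom.left = matrixMor K b c (g.1 0 0) (g.1 1 0) := rfl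

variable (K L) in
/-- The automorphism group of `M ⊗_K L` is the matrix group. -/
def matrixAutEquiv [CharZero L] (hb : 0 < b) (hbc : b ≤ c) :
    matrixGroup L (c / b) ≃* AutOver L (splitMonoid K b c) :=
  MulEquiv.ofBijective
    (MonoidHom.mk' (matrixAut K hbc) fun g h => autOver_ext (matrixHom_comp h g).symm)
    ⟨fun g h hgh => by
      have := matrixMor_injective (congrArg (fun f => f.hom.hom.left) hgh)
      exact matrixGroup_ext this.1 this.2,
    fun f => by
      obtain ⟨α, γ, hα, h⟩ := exists_eq_matrixMor hb hbc f
      exact ⟨mkMatrix _ α γ hα, autOver_ext h.symm⟩⟩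

theorem pullbackFun_matrixAut (hbc : b ≤ c) (g : matrixGroup L (c / b)) (i : Fin 3) :
    pullbackFun (matrixAut K hbc g) (coordFun K b c L i) =
      matrixAct b c (constFun K b c L (g.1 0 0)) (constFun K b c L (g.1 1 0))
        (coordFun K b c L) i :=
  matrixMor_coordFun _ _ i

/-- The semidirect product decomposition of the matrix group. -/
def semidirectEquiv (L : Type*) [Field L] (d : ℕ) :
    (Multiplicative L ⋊[twistAction L d] Lˣ) ≃* matrixGroup L d :=
  MulEquiv.ofBijective
    -- The matrix is the product of the unipotent one with entry γ and diag(α, α^(d+1)); conjugation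
    -- by the latter multiplies γ by α^(d+1)/α = α^d.
    (MonoidHom.mk' (fun p => mkMatrix d (p.right : L) (Multiplicative.toAdd p.left * (p.right : L)) p.right.ne_zero)
      fun p q => matrixGroup_ext
        (by rw [matrixGroup_mul_zero_zero]; rfl)
        (by
          rw [matrixGroup_mul_one_zero]
          change (Multiplicative.toAdd p.left + (p.right : L) ^ d * Multiplicative.toAdd q.left) * ((p.right : L) * q.right) =
            Multiplicative.toAdd p.left * (p.right : L) * q.right +
              (p.right : L) ^ (d + 1) * (Multiplicative.toAdd q.left * (q.right : L))
          ring))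
    ⟨fun p q h => by
      have h0 : (p.right : L) = q.right := congrArg (fun g => g.1 0 0) h
      have h1 : Multiplicative.toAdd p.left * (p.right : L) =
          Multiplicative.toAdd q.left * (q.right : L) := congrArg (fun g => g.1 1 0) h
      rw [h0] at h1
      have h2 : Multiplicative.toAdd p.left = Multiplicative.toAdd q.left :=
        mul_right_cancel₀ q.right.ne_zero h1
      exact SemidirectProduct.ext h2 (Units.ext h0),
    fun g => ⟨⟨Multiplicative.ofAdd (g.1 1 0 / g.1 0 0), Units.mk0 _ (matrixGroup_ne_zero g)⟩,
      matrixGroup_ext rfl (div_mul_cancel₀ _ (matrixGroup_ne_zero g))⟩⟩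

end automorphisms

/-! ### Galois action on the matrices and Hilbert 90 -/

section galois

variable {K : Type u} [Field K] {b c : ℕ} {L : Type u} [Field L] [Algebra K L]

theorem galHom_constFun (σ : L ≃ₐ[K] L) (l : L) :
    (galHom (splitMonoid K b c) σ).appTop.hom (constFun K b c L l) =
      constFun K b c L (σ⁻¹ l) := by
  have h := congrArg ofSpecHom (galHom_hom (splitMonoid K b c) σ)
  rw [ofSpecHom_comp, ofSpecHom_comp_map] at h
  exact RingHom.congr_fun h l

theorem galHom_coordFun (σ : L ≃ₐ[K] L) (i : Fin 3) :
    (galHom (splitMonoid K b c) σ).appTop.hom (coordFun K b c L i) = coordFun K b c L i := by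
  have h : galHom (splitMonoid K b c) σ ≫ baseProj K b c L = baseProj K b c L := galHom_proj _ σ
  replace h := congrArg ofSpecHom h
  rw [ofSpecHom_comp] at h
  exact RingHom.congr_fun h _

/-- The Galois group acts on automorphisms through the matrix entries. -/
theorem galHom_matrixMor (σ : L ≃ₐ[K] L) (α γ : L) :
    galHom (splitMonoid K b c) σ⁻¹ ≫ matrixMor K b c α γ ≫ galHom (splitMonoid K b c) σ =
      matrixMor K b c (σ α) (σ γ) := by
  -- Coordinates come from M and are fixed by the Galois group, while `galHom` at σ⁻¹ acts on
  -- constants by σ. Conjugation therefore changes only the entries.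
  refine basePt_ext (fun l => ?_) (fun i => ?_)
  · rw [appTop_comp_apply, appTop_comp_apply, galHom_constFun, matrixMor_constFun,
      galHom_constFun, matrixMor_constFun]
    simp
  · rw [appTop_comp_apply, appTop_comp_apply, galHom_coordFun, matrixMor_coordFun, map_matrixAct,
      matrixMor_coordFun]
    simp [galHom_constFun, galHom_coordFun]

theorem smul_matrixAut_left (hbc : b ≤ c) (σ : L ≃ₐ[K] L) (g : matrixGroup L (c / b)) :
    (σ • matrixAut K hbc g).hom.hom.left = matrixMor K b c (σ (g.1 0 0)) (σ (g.1 1 0)) :=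
  galHom_matrixMor σ _ _

/-- The additive form of Hilbert's Theorem 90. -/
theorem exists_eq_sub_of_additive_cocycle [FiniteDimensional K L] [IsGalois K L]
    (f : (L ≃ₐ[K] L) → L) (hf : ∀ τ ρ, f (τ * ρ) = f τ + τ (f ρ)) :
    ∃ y, ∀ σ, f σ = y - σ y := by
  -- For θ of trace 1 put y = ∑ f(ρ) ρ(θ). Applying σ and using σ(f ρ) = f(σρ) - f(σ) gives σ(y) = y
  -- - f(σ).
  obtain ⟨θ, hθ⟩ := Algebra.trace_surjective K L 1
  have hθ' : ∑ σ : L ≃ₐ[K] L, σ θ = 1 := by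
    rw [← trace_eq_sum_automorphisms, hθ, map_one]
  refine ⟨∑ ρ, f ρ * ρ θ, fun σ => ?_⟩
  have h1 : ∑ ρ, f ρ * ρ θ = ∑ ρ : L ≃ₐ[K] L, f (σ * ρ) * (σ * ρ) θ :=
    (Fintype.sum_equiv (Equiv.mulLeft σ) _ _ fun ρ => rfl).symm
  have h2 : ∑ ρ : L ≃ₐ[K] L, σ (ρ θ) = 1 := by rw [← map_sum, hθ', map_one]
  have h3 : ∑ ρ : L ≃ₐ[K] L, f (σ * ρ) * (σ * ρ) θ = f σ + σ (∑ ρ, f ρ * ρ θ) := by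
    simp only [hf, map_sum, map_mul, AlgEquiv.mul_apply, add_mul, Finset.sum_add_distrib]
    rw [← Finset.mul_sum, h2, mul_one]
  linear_combination -(h1.trans h3)

/-- Hilbert's Theorem 90 for the matrix group. -/
theorem exists_matrix_of_cocycle [FiniteDimensional K L] [IsGalois K L] (d : ℕ)
    (α γ : (L ≃ₐ[K] L) → L) (hα0 : ∀ σ, α σ ≠ 0) (hα : ∀ τ ρ, α (τ * ρ) = α τ * τ (α ρ))
    (hγ : ∀ τ ρ, γ (τ * ρ) = γ τ * τ (α ρ) + α τ ^ (d + 1) * τ (γ ρ)) :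
    ∃ a z : L, a ≠ 0 ∧ ∀ σ, α σ * σ a = a ∧ γ σ * σ a + α σ ^ (d + 1) * σ z = z := by
  -- Multiplicative Hilbert 90 trivialises the diagonal; a = β⁻¹ satisfies α_σ σ(a) = a.
  obtain ⟨β, hβ⟩ := groupCohomology.isMulCoboundary₁_of_isMulCocycle₁_of_aut_to_units
    (fun σ => Units.mk0 (α σ) (hα0 σ)) (fun τ ρ => Units.ext (by
      simp [hα, mul_comm, AlgEquiv.smul_units_def]))
  have ha : ∀ σ, α σ * σ (β⁻¹ : Lˣ) = (β⁻¹ : Lˣ) := by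
    intro σ
    have := congrArg Units.val (hβ σ)
    simp [AlgEquiv.smul_units_def] at this
    rw [← this]
    have : σ (β : L) ≠ 0 := by simp
    simp
    field_simp
  generalize (β⁻¹ : Lˣ) = a at ha
  have ha0 : (a : L) ≠ 0 := a.ne_zero
  have hσa : ∀ σ : L ≃ₐ[K] L, σ (a : L) ≠ 0 := fun σ => by simp
  -- Dividing the required equation by a^(d+1) and writing z = a^(d+1) y turns it into γ_σ
  -- σ(a)/a^(d+1) = y - σ(y), since α_σ^(d+1) σ(a)^(d+1) = a^(d+1).
  obtain ⟨y, hy⟩ := exists_eq_sub_of_additive_cocycle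
    (fun σ => γ σ * σ (a : L) / (a : L) ^ (d + 1)) (fun τ ρ => by
      have e1 := ha τ
      have e2 := congrArg τ (ha ρ)
      rw [map_mul] at e2
      have e3 : (α τ) ^ (d + 1) * τ (a : L) ^ (d + 1) = (a : L) ^ (d + 1) := by rw [← mul_pow, e1]
      have := hσa τ
      simp only [map_div₀, map_mul, map_pow, hγ, AlgEquiv.mul_apply]
      rw [← e3]
      have := hα0 τ
      field_simp
      linear_combination γ τ * e2)
  refine ⟨a, a ^ (d + 1) * y, ha0, fun σ => ⟨ha σ, ?_⟩⟩
  have e1 := hy σ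
  have e3 : (α σ) ^ (d + 1) * σ (a : L) ^ (d + 1) = (a : L) ^ (d + 1) := by rw [← mul_pow, ha]
  rw [div_eq_iff (pow_ne_zero _ ha0)] at e1
  rw [map_mul, map_pow, ← mul_assoc, e3]
  linear_combination e1

/-- Every cocycle with values in the automorphism group is a coboundary. -/
theorem exists_cocycle_eq [CharZero L] [FiniteDimensional K L] [IsGalois K L] (hb : 0 < b)
    (hbc : b ≤ c) (f : Cocycle (L ≃ₐ[K] L) (AutOver L (splitMonoid K b c))) :
    ∃ a : AutOver L (splitMonoid K b c), ∀ σ, f.1 σ * σ • a = a := by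
  choose g hg using fun σ => (matrixAutEquiv K L hb hbc).surjective (f.1 σ)
  have hg' : ∀ σ, f.1 σ = matrixAut K hbc (g σ) := fun σ => (hg σ).symm
  -- The entries are determined by the automorphism, so the cocycle law can be read off entrywise.
  have hmul : ∀ τ ρ, (g (τ * ρ)).1 0 0 = (g τ).1 0 0 * τ ((g ρ).1 0 0) ∧ (g (τ * ρ)).1 1 0 =
      (g τ).1 1 0 * τ ((g ρ).1 0 0) + (g τ).1 0 0 ^ (c / b + 1) * τ ((g ρ).1 1 0) := by
    intro τ ρ
    apply matrixMor_injective (K := K) (b := b) (c := c)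
    rw [← matrixAut_left hbc, ← hg', f.2, ← matrixMor_comp, ← smul_matrixAut_left hbc, ← hg',
      ← matrixAut_left hbc, ← hg']
    rfl
  obtain ⟨a, z, ha, h⟩ := exists_matrix_of_cocycle (c / b) (fun σ => (g σ).1 0 0)
    (fun σ => (g σ).1 1 0) (fun σ => matrixGroup_ne_zero (g σ)) (fun τ ρ => (hmul τ ρ).1)
    (fun τ ρ => (hmul τ ρ).2)
  refine ⟨matrixAut K hbc (mkMatrix _ a z ha), fun σ => autOver_ext ?_⟩
  have e : (f.1 σ * σ • matrixAut K hbc (mkMatrix _ a z ha)).hom.hom.left =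
      (σ • matrixAut K hbc (mkMatrix _ a z ha)).hom.hom.left ≫ (f.1 σ).hom.hom.left := rfl
  rw [e, smul_matrixAut_left, hg', matrixAut_left, matrixMor_comp, matrixAut_left]
  congr 1
  · exact (h σ).1
  · exact (h σ).2

theorem h1_eq_base [CharZero L] [FiniteDimensional K L] [IsGalois K L] (hb : 0 < b)
    (hbc : b ≤ c) (x : H1 (L ≃ₐ[K] L) (AutOver L (splitMonoid K b c))) : x = H1.base _ _ := by
  induction x using Quotient.inductionOn with | h f => ?_
  obtain ⟨a, ha⟩ := exists_cocycle_eq hb hbc f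
  refine Quotient.sound ⟨a⁻¹, fun σ => ?_⟩
  rw [smul_inv', inv_inv, mul_assoc, ha, inv_mul_cancel]

end galois

/-! ### The direct limit over finite Galois extensions -/

section limit

variable {K : Type u} [Field K] (M : MonoidScheme K)

theorem isInflation_one {L L' : Type u} [Field L] [Algebra K L] [Field L'] [Algebra K L']
    (j : L →ₐ[K] L') : IsInflation M j ⟨fun _ => 1, fun _ _ => by simp⟩
      ⟨fun _ => 1, fun _ _ => by simp⟩ :=
  fun _ _ _ => (Category.id_comp _).trans (Category.comp_id _).symm

/-- The base point lives at the level `⊥`, and inflating the trivial cocycle from there to F gives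
the trivial cocycle. -/
theorem absoluteH1_eq_base (h : ∀ (F : FiniteGaloisIntermediateField K (AlgebraicClosure K))
    (x : H1 (F ≃ₐ[K] F) (AutOver F M)), x = H1.base _ _) (x : AbsoluteH1 M) :
    x = AbsoluteH1.base M := by
  obtain ⟨⟨F, x⟩, rfl⟩ := Quot.exists_rep x
  rw [h F x]
  exact (Quot.sound ⟨bot_le, ⟨fun _ => 1, fun _ _ => by simp⟩, ⟨fun _ => 1, fun _ _ => by simp⟩,
    rfl, rfl, isInflation_one M _⟩).symm

end limit

end SplitMonoid
end

/-! ### Morphisms to Spec L that agree over K -/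

noncomputable section
namespace TwistedForms
open AlgebraicGeometry CategoryTheory Limits MonoidalCategory CartesianMonoidalCategory MonObj
open SplitMonoid (ofSpecHom ofSpecHom_comp ofSpecHom_comp_map ofSpecHom_injective)

section locality

theorem isUnit_basicOpen_ι_appTop {Z : Scheme.{u}} (s : Γ(Z, ⊤)) :
    IsUnit ((Z.basicOpen s).ι.appTop.hom s) := by
  have h := (RingedSpace.isUnit_res_basicOpen Z.toRingedSpace s).map
    (Z.presheaf.map (homOfLE (x := (Z.basicOpen s).ι ''ᵁ ⊤) (y := Z.basicOpen s)
      (by simp)).op).hom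
  rw [Scheme.Opens.ι_appTop]
  have e : Z.presheaf.map (homOfLE (x := (Z.basicOpen s).ι ''ᵁ ⊤) le_top).op =
      Z.presheaf.map (homOfLE (Z.basicOpen_le s)).op ≫ Z.presheaf.map (homOfLE (by simp)).op :=
    Z.presheaf.map_comp _ _
  rw [e]
  exact h

variable {K L : Type u} [Field K] [Field L] [Algebra K L] [IsGalois K L]

/-- Two `K`-embeddings of `L` into a field differ by an element of the Galois group. -/
theorem exists_algEquiv_of_comp_algebraMap_eq {κ : Type*} [Field κ] (φ ψ : L →+* κ)
    (h : ∀ k, φ (algebraMap K L k) = ψ (algebraMap K L k)) :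
    ∃ τ : L ≃ₐ[K] L, ∀ x, ψ x = φ (τ x) := by
  let := φ.toAlgebra
  let := (φ.comp (algebraMap K L)).toAlgebra
  have : IsScalarTower K L κ := .of_algebraMap_eq fun _ => rfl
  let ψ' : L →ₐ[K] κ := ⟨ψ, fun k => (h k).symm⟩
  exact ⟨Normal.algHomEquivAut K κ L ψ', fun x =>
    (DFunLike.congr_fun ((Normal.algHomEquivAut K κ L).symm_apply_apply ψ') x).symm⟩

/-- Two ring homomorphisms on `L` that agree on `K` differ near a point by an element of the
Galois group. -/
theorem exists_mul_sub_eq_zero {R κ : Type*} [CommRing R] [Field κ] (φ ψ : L →+* R)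
    (h : ∀ k, φ (algebraMap K L k) = ψ (algebraMap K L k)) (e : R →+* κ) (θ : L) :
    ∃ (τ : L ≃ₐ[K] L) (s : R), e s ≠ 0 ∧ s * (ψ θ - φ (τ θ)) = 0 := by
  obtain ⟨τ, hτ⟩ := exists_algEquiv_of_comp_algebraMap_eq (K := K) (e.comp φ) (e.comp ψ)
    (fun k => congrArg e (h k))
  have hmin : (minpoly K θ).Separable := IsGalois.separable K θ
  have hsep : ((minpoly K θ).map (algebraMap K L)).Separable := hmin.map
  have hroot : ((minpoly K θ).map (algebraMap K L)).IsRoot (τ θ) := by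
    rw [Polynomial.IsRoot, Polynomial.eval_map_algebraMap, ← AlgEquiv.coe_toAlgHom,
      Polynomial.aeval_algHom_apply, minpoly.aeval, map_zero]
  obtain ⟨q, hq⟩ := Polynomial.dvd_iff_isRoot.mpr hroot
  -- With minpoly = (X - τθ) q over L, the value q(τθ) is the derivative of the minimal polynomial
  -- at τθ, nonzero by separability.
  have hq0 : q.eval (τ θ) ≠ 0 := by
    intro h0
    have := hsep.eval₂_derivative_ne_zero (RingHom.id L) (x := τ θ) (by simpa using hroot)
    apply this
    rw [hq]
    simp [h0]
  -- Under `e` this element becomes the image of q(τθ), hence nonzero. Its product with ψ(θ) - φ(τθ)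
  -- is the minimal polynomial evaluated at ψ(θ), hence zero.
  refine ⟨τ, q.eval₂ φ (ψ θ), ?_, ?_⟩
  · rw [Polynomial.hom_eval₂]
    have : e (ψ θ) = (e.comp φ) (τ θ) := hτ θ
    rw [this, Polynomial.eval₂_at_apply]
    exact (map_ne_zero _).mpr hq0
  · have h1 := congrArg (Polynomial.eval₂ φ (ψ θ)) hq
    rw [Polynomial.eval₂_map, Polynomial.eval₂_mul, Polynomial.eval₂_sub, Polynomial.eval₂_X,
      Polynomial.eval₂_C] at h1
    have h2 : φ.comp (algebraMap K L) = ψ.comp (algebraMap K L) := RingHom.ext h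
    rw [h2, ← Polynomial.hom_eval₂, ← Polynomial.aeval_def, minpoly.aeval, map_zero] at h1
    rw [mul_comm, ← h1]

/-- Two `K`-morphisms to `Spec L` differ locally by an element of the Galois group. -/
theorem exists_specGal_of_comp_specMap_eq [FiniteDimensional K L] {Z : Scheme.{u}} (f g : Z ⟶ Spec (CommRingCat.of L))
    (h : f ≫ specMap K L = g ≫ specMap K L) (z : Z) :
    ∃ (U : Z.Opens) (σ : L ≃ₐ[K] L), z ∈ U ∧ U.ι ≫ g = U.ι ≫ f ≫ specGal σ := by
  have hK : ∀ k, ofSpecHom f (algebraMap K L k) = ofSpecHom g (algebraMap K L k) := by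
    have := congrArg ofSpecHom h
    rw [ofSpecHom_comp_map, ofSpecHom_comp_map] at this
    exact RingHom.congr_fun this
  -- A primitive element suffices: homomorphisms from L that agree on K and on a generator are
  -- equal.
  let pb := Field.powerBasisOfFiniteOfSeparable K L
  obtain ⟨τ, s, hs, hz⟩ := exists_mul_sub_eq_zero (ofSpecHom f) (ofSpecHom g) hK
    (Z.Γevaluation z).hom pb.gen
  -- The inverse appears because `specGal σ` is Spec of σ⁻¹. On this open set s is invertible and
  -- can be cancelled.
  refine ⟨Z.basicOpen s, τ⁻¹, (Z.evaluation_ne_zero_iff_mem_basicOpen z (U := ⊤) trivial s).mp hs, ?_⟩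
  let ρ := (Z.basicOpen s).ι.appTop.hom
  have hgen : ρ (ofSpecHom g pb.gen) = ρ (ofSpecHom f (τ pb.gen)) := by
    have := congrArg ρ hz
    rw [map_mul, map_zero, (isUnit_basicOpen_ι_appTop s).mul_right_eq_zero, map_sub,
      sub_eq_zero] at this
    exact this
  apply ofSpecHom_injective
  rw [ofSpecHom_comp, ofSpecHom_comp, ofSpecHom_comp_map, inv_inv]
  let := (ρ.comp ((ofSpecHom f).comp (algebraMap K L))).toAlgebra
  let A : L →ₐ[K] Γ(Z.basicOpen s, ⊤) := ⟨ρ.comp (ofSpecHom g), fun k => congrArg ρ (hK k).symm⟩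
  let B : L →ₐ[K] Γ(Z.basicOpen s, ⊤) := ⟨(ρ.comp (ofSpecHom f)).comp τ.toRingHom, fun k => by
    simp [RingHom.algebraMap_toAlgebra]⟩
  have hAB : A = B := pb.algHom_ext hgen
  exact congrArg AlgHom.toRingHom hAB

end locality

/-! ### Galois descent for morphisms -/

section descent

variable {K : Type u} [Field K] {L : Type u} [Field L] [Algebra K L]
variable {M M' : MonoidScheme K}

/-- The projection is a base change of Spec L ⟶ Spec K. A morphism out of M is thus a morphism out
of M ⊗_K L that does not distinguish points with the same image in M. -/
instance (M : MonoidScheme K) (L : Type u) [Field L] [Algebra K L] : EffectiveEpi (proj M L) :=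
  inferInstanceAs (EffectiveEpi (pullback.fst M.X.hom (specMap K L)))

/-- Galois descent for morphisms of schemes. -/
theorem exists_descent [FiniteDimensional K L] [IsGalois K L]
    (ψ : ((baseChange K L).obj M).X.left ⟶ ((baseChange K L).obj M').X.left)
    (hψ : ∀ σ : L ≃ₐ[K] L, galHom M σ ≫ ψ = ψ ≫ galHom M' σ) :
    ∃ χ : M.X.left ⟶ M'.X.left, proj M L ≫ χ = ψ ≫ proj M' L := by
  refine ⟨EffectiveEpi.desc (proj M L) (ψ ≫ proj M' L) fun {Z} g₁ g₂ h => ?_,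
    EffectiveEpi.fac _ _ _⟩
  refine Scheme.hom_ext_of_forall _ _ fun z => ?_
  -- Two points of M ⊗_K L over the same point of M differ only in their map to Spec L, so locally
  -- by some `galHom M σ`; equivariance of `ψ` moves it past `ψ`, where the projection to M' absorbs
  -- it.
  obtain ⟨U, σ, hz, hU⟩ := exists_specGal_of_comp_specMap_eq (K := K)
    (g₁ ≫ ((baseChange K L).obj M).X.hom) (g₂ ≫ ((baseChange K L).obj M).X.hom) (by
      rw [Category.assoc, Category.assoc, ← proj_hom, reassoc_of% h]) z
  have hg : U.ι ≫ g₂ = U.ι ≫ g₁ ≫ galHom M σ := by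
    apply baseChange_hom_ext
    · simp only [Category.assoc, galHom_proj, h]
    · simp only [Category.assoc, galHom_hom] at hU ⊢
      exact hU
  refine ⟨U, hz, ?_⟩
  rw [← Category.assoc U.ι g₂, hg]
  simp only [Category.assoc]
  rw [← Category.assoc (galHom M σ), hψ, Category.assoc, galHom_proj]

/-- Up to the monoidal comparison isomorphism this is the base change of Spec L ⟶ Spec K along M ×
M. It lets compatibility with multiplication be checked over L. -/
theorem prodMap_proj_epi (M : MonoidScheme K) :
    Epi (prodMap _ _ (proj M L) (specMap K L) (proj_hom M)) := by
  have h : (Functor.LaxMonoidal.μ (Over.pullback (specMap K L)) M.X M.X).left ≫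
      pullback.fst (M.X ⊗ M.X).hom (specMap K L) =
        prodMap _ _ (proj M L) (specMap K L) (proj_hom M) := by
    apply pullback.hom_ext
    · exact ((Category.assoc _ _ _).trans (Over.μ_pullback_left_fst_fst _ _)).trans
        (prodMap_fst _ _ _ _ _).symm
    · exact ((Category.assoc _ _ _).trans (Over.μ_pullback_left_fst_snd _ _)).trans
        (prodMap_snd _ _ _ _ _).symm
  have h₁ : IsIso (Functor.LaxMonoidal.μ (Over.pullback (specMap K L)) M.X M.X).left :=
    inferInstanceAs (IsIso ((Over.forget _).map
      (Functor.LaxMonoidal.μ (Over.pullback (specMap K L)) M.X M.X)))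
  have h₂ : Epi (pullback.fst (M.X ⊗ M.X).hom (specMap K L)) := inferInstance
  rw [← h]
  exact @epi_comp _ _ _ _ _ _ (@IsIso.epi_of_iso _ _ _ _ _ h₁) _ h₂

/-- Galois descent for morphisms of monoid schemes. -/
theorem exists_monoidScheme_descent [FiniteDimensional K L] [IsGalois K L]
    (ψ : (baseChange K L).obj M ⟶ (baseChange K L).obj M')
    (hψ : ∀ σ : L ≃ₐ[K] L, galHom M σ ≫ ψ.hom.left = ψ.hom.left ≫ galHom M' σ) :
    ∃ χ : M ⟶ M', proj M L ≫ χ.hom.left = ψ.hom.left ≫ proj M' L := by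
  obtain ⟨χ, hχ⟩ := exists_descent ψ.hom.left hψ
  -- Each condition on `χ` is checked after composing with an epimorphism from the corresponding
  -- object over L, where it holds for `ψ`.
  have hover : χ ≫ M'.X.hom = M.X.hom := by
    rw [← cancel_epi (proj M L), reassoc_of% hχ, proj_hom, proj_hom]
    exact (Category.assoc _ _ _).symm.trans (congrArg (· ≫ specMap K L) (Over.w ψ.hom))
  have hone : oneMorBase M ≫ χ = oneMorBase M' := by
    rw [← cancel_epi (specMap K L), ← oneMor_proj, ← Category.assoc, ← oneMor_proj, Category.assoc,
      hχ, ← Category.assoc]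
    exact congrArg (· ≫ proj M' L) (congrArg Over.Hom.left (IsMonHom.one_hom ψ.hom))
  have hmul : mulMorBase M ≫ χ =
      prodMap _ _ χ (𝟙 _) (hover.trans (Category.comp_id _).symm) ≫ mulMorBase M' := by
    have := prodMap_proj_epi (L := L) M
    rw [← cancel_epi (prodMap _ _ (proj M L) (specMap K L) (proj_hom M)), ← Category.assoc,
      ← mulMor_proj, Category.assoc, hχ, ← Category.assoc]
    have h1 : mulMor M L ≫ ψ.hom.left =
        prodMap _ _ ψ.hom.left (𝟙 _) ((Over.w ψ.hom).trans (Category.comp_id _).symm) ≫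
          mulMor M' L :=
      congrArg Over.Hom.left (IsMonHom.mul_hom ψ.hom)
    rw [h1, Category.assoc, mulMor_proj, ← Category.assoc, ← Category.assoc]
    congr 1
    have w : (ψ.hom.left ≫ proj M' L) ≫ M'.X.hom =
        ((baseChange K L).obj M).X.hom ≫ specMap K L := by
      rw [Category.assoc, proj_hom]
      exact (Category.assoc _ _ _).symm.trans (congrArg (· ≫ specMap K L) (Over.w ψ.hom))
    rw [prodMap_comp (h' := w) (e := rfl), prodMap_comp (h' := w) (e := hχ)]
  exact ⟨Mon.Hom.mk' (Over.homMk χ hover) (by ext1; exact hone) (by ext1; exact hmul), hχ⟩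

/-- Galois descent for isomorphisms of monoid schemes. -/
theorem nonempty_iso_of_descent [FiniteDimensional K L] [IsGalois K L]
    (ψ : (baseChange K L).obj M ≅ (baseChange K L).obj M')
    (hψ : ∀ σ : L ≃ₐ[K] L, galHom M σ ≫ ψ.hom.hom.left = ψ.hom.hom.left ≫ galHom M' σ) :
    Nonempty (M ≅ M') := by
  have h1 : ψ.hom.hom.left ≫ ψ.inv.hom.left = 𝟙 _ := congrArg (fun t => t.hom.left) ψ.hom_inv_id
  have h2 : ψ.inv.hom.left ≫ ψ.hom.hom.left = 𝟙 _ := congrArg (fun t => t.hom.left) ψ.inv_hom_id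
  obtain ⟨χ, hχ⟩ := exists_monoidScheme_descent ψ.hom hψ
  obtain ⟨χ', hχ'⟩ := exists_monoidScheme_descent ψ.inv fun σ => by
    have : Mono ψ.hom.hom.left := ⟨fun a b h => by
      rw [← Category.comp_id a, ← Category.comp_id b, ← h1, reassoc_of% h]⟩
    rw [← cancel_mono ψ.hom.hom.left, Category.assoc, Category.assoc, h2, hψ, reassoc_of% h2,
      Category.comp_id]
  refine ⟨χ, χ', ?_, ?_⟩
  · apply Mon.Hom.ext
    apply Over.OverMorphism.ext
    rw [← cancel_epi (proj M L)]
    refine (Category.assoc _ _ _).symm.trans ?_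
    refine (congrArg (· ≫ χ'.hom.left) hχ).trans ?_
    rw [Category.assoc, hχ', reassoc_of% h1]
    exact (Category.comp_id _).symm
  · apply Mon.Hom.ext
    apply Over.OverMorphism.ext
    rw [← cancel_epi (proj M' L)]
    refine (Category.assoc _ _ _).symm.trans ?_
    refine (congrArg (· ≫ χ.hom.left) hχ').trans ?_
    rw [Category.assoc, hχ, reassoc_of% h2]
    exact (Category.comp_id _).symm

end descent

/-! ### Twisted forms and their cocycles -/

section forms

variable {K : Type u} [Field K] {L : Type u} [Field L] [Algebra K L] {M M' : MonoidScheme K}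

/-- The conjugate of a morphism `M ⊗_K L ⟶ M' ⊗_K L` by an element of the Galois group. -/
def conjHom (σ : L ≃ₐ[K] L) (f : (baseChange K L).obj M ⟶ (baseChange K L).obj M') :
    (baseChange K L).obj M ⟶ (baseChange K L).obj M' :=
  have hf : f.hom.left ≫ ((baseChange K L).obj M').X.hom = ((baseChange K L).obj M).X.hom :=
    Over.w f.hom
  have h1 : oneMor M L ≫ f.hom.left = oneMor M' L :=
    congrArg Over.Hom.left (IsMonHom.one_hom f.hom)
  have hm : mulMor M L ≫ f.hom.left =
      prodMap _ _ f.hom.left (𝟙 _) (hf.trans (Category.comp_id _).symm) ≫ mulMor M' L :=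
    congrArg Over.Hom.left (IsMonHom.mul_hom f.hom)
  have ho : (galHom M σ⁻¹ ≫ f.hom.left ≫ galHom M' σ) ≫ ((baseChange K L).obj M').X.hom =
      ((baseChange K L).obj M).X.hom := by
    simp only [Category.assoc]
    rw [galHom_hom, ← Category.assoc f.hom.left, hf, ← Category.assoc, galHom_hom, Category.assoc,
      specGal_inv, Category.comp_id]
  have hone : oneMor M L ≫ galHom M σ⁻¹ ≫ f.hom.left ≫ galHom M' σ = oneMor M' L := by
    rw [← Category.assoc, ← specGal_oneMor, Category.assoc, ← Category.assoc (oneMor M L), h1,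
      ← specGal_oneMor, ← Category.assoc, specGal_inv, Category.id_comp]
  have hmul : mulMor M L ≫ galHom M σ⁻¹ ≫ f.hom.left ≫ galHom M' σ =
      prodMap _ _ (galHom M σ⁻¹ ≫ f.hom.left ≫ galHom M' σ) (𝟙 _)
        (ho.trans (Category.comp_id _).symm) ≫ mulMor M' L := by
    rw [← Category.assoc, ← prodMap_mulMor, Category.assoc, ← Category.assoc (mulMor M L), hm,
      Category.assoc, ← prodMap_mulMor, ← Category.assoc, ← Category.assoc]
    congr 1
    rw [Category.assoc, prodMap_comp (h' := by
        rw [Category.assoc, galHom_hom, ← Category.assoc, hf]) (e := rfl),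
      prodMap_comp (e := rfl)]
  Mon.Hom.mk' (Over.homMk (galHom M σ⁻¹ ≫ f.hom.left ≫ galHom M' σ) ho)
    (by ext1; exact hone) (by ext1; exact hmul)

theorem conjHom_left (σ : L ≃ₐ[K] L) (f : (baseChange K L).obj M ⟶ (baseChange K L).obj M') :
    (conjHom σ f).hom.left = galHom M σ⁻¹ ≫ f.hom.left ≫ galHom M' σ := rfl

theorem baseChange_monHom_ext {f g : (baseChange K L).obj M ⟶ (baseChange K L).obj M'}
    (h : f.hom.left = g.hom.left) : f = g :=
  Mon.Hom.ext (Over.OverMorphism.ext h)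

theorem comp_left {M'' : MonoidScheme K} (f : (baseChange K L).obj M ⟶ (baseChange K L).obj M')
    (g : (baseChange K L).obj M' ⟶ (baseChange K L).obj M'') :
    (f ≫ g).hom.left = f.hom.left ≫ g.hom.left := rfl

theorem conjHom_comp {M'' : MonoidScheme K} (σ : L ≃ₐ[K] L)
    (f : (baseChange K L).obj M ⟶ (baseChange K L).obj M')
    (g : (baseChange K L).obj M' ⟶ (baseChange K L).obj M'') :
    conjHom σ f ≫ conjHom σ g = conjHom σ (f ≫ g) := by
  apply baseChange_monHom_ext
  rw [comp_left, conjHom_left, conjHom_left, conjHom_left, comp_left]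
  simp only [Category.assoc]
  rw [← Category.assoc (galHom M' σ) (galHom M' σ⁻¹), galHom_inv', Category.id_comp]

theorem conjHom_id (σ : L ≃ₐ[K] L) : conjHom σ (𝟙 ((baseChange K L).obj M)) = 𝟙 _ :=
  baseChange_monHom_ext (conj_id σ)

theorem conjHom_mul (σ τ : L ≃ₐ[K] L)
    (f : (baseChange K L).obj M ⟶ (baseChange K L).obj M') :
    conjHom (σ * τ) f = conjHom σ (conjHom τ f) := by
  apply baseChange_monHom_ext
  rw [conjHom_left, conjHom_left, conjHom_left, mul_inv_rev, galHom_mul, galHom_mul]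
  simp only [Category.assoc]

/-- The conjugate of an isomorphism `M ⊗_K L ≅ M' ⊗_K L` by an element of the Galois group. -/
@[simps]
def conjIso (σ : L ≃ₐ[K] L) (φ : (baseChange K L).obj M ≅ (baseChange K L).obj M') :
    (baseChange K L).obj M ≅ (baseChange K L).obj M' where
  hom := conjHom σ φ.hom
  inv := conjHom σ φ.inv
  hom_inv_id := by rw [conjHom_comp, φ.hom_inv_id, conjHom_id]
  inv_hom_id := by rw [conjHom_comp, φ.inv_hom_id, conjHom_id]

/-- The cocycle of a twisted form. -/
def formCocycle (φ : (baseChange K L).obj M ≅ (baseChange K L).obj M') :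
    Cocycle (L ≃ₐ[K] L) (AutOver L M) :=
  ⟨fun σ => conjIso σ φ ≪≫ φ.symm, fun τ ρ => by
    apply Iso.ext
    change conjHom (τ * ρ) φ.hom ≫ φ.inv =
      conjHom τ (conjHom ρ φ.hom ≫ φ.inv) ≫ conjHom τ φ.hom ≫ φ.inv
    rw [conjHom_mul, ← Category.assoc, conjHom_comp, Category.assoc, φ.inv_hom_id,
      Category.comp_id]⟩

/-- A twisted form whose cocycle is a coboundary is trivial. -/
theorem nonempty_iso_of_formCocycle [FiniteDimensional K L] [IsGalois K L]
    (φ : (baseChange K L).obj M ≅ (baseChange K L).obj M') {a : AutOver L M}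
    (ha : ∀ σ : L ≃ₐ[K] L, (formCocycle φ).1 σ * σ • a = a) : Nonempty (M ≅ M') := by
  refine nonempty_iso_of_descent (a ≪≫ φ) fun σ => ?_
  -- The equation φ⁻¹ ∘ σ(φ) ∘ σ(a) = a says that φ ∘ a is fixed by conjugation, that is, Galois
  -- equivariant.
  have h : conjHom σ a.hom ≫ conjHom σ φ.hom ≫ φ.inv = a.hom := congrArg Iso.hom (ha σ)
  rw [← Category.assoc, Iso.comp_inv_eq, conjHom_comp] at h
  have h' : galHom M σ⁻¹ ≫ (a.hom ≫ φ.hom).hom.left ≫ galHom M' σ = (a.hom ≫ φ.hom).hom.left :=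
    congrArg (fun t => t.hom.left) h
  change galHom M σ ≫ (a.hom ≫ φ.hom).hom.left = (a.hom ≫ φ.hom).hom.left ≫ galHom M' σ
  conv_lhs => rw [← h']
  rw [← Category.assoc, galHom_inv', Category.id_comp]

/-- If all cocycles are coboundaries, then there are no nontrivial twisted forms. -/
theorem hasNoNontrivialTwistedForms_of_cocycle (M : MonoidScheme K)
    (h : ∀ (L : Type u) [Field L] [Algebra K L] [FiniteDimensional K L] [IsGalois K L]
      (f : Cocycle (L ≃ₐ[K] L) (AutOver L M)), ∃ a : AutOver L M, ∀ σ, f.1 σ * σ • a = a) :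
    HasNoNontrivialTwistedForms M := by
  rintro M' - L _ _ _ _ ⟨φ⟩
  obtain ⟨a, ha⟩ := h L (formCocycle φ)
  obtain ⟨e⟩ := nonempty_iso_of_formCocycle φ ha
  exact ⟨e.symm⟩

end forms

end TwistedForms
end

/-! ### The theorem -/

theorem proposition5p2 {K : Type u} [Field K] [CharZero K] (b c : ℕ) (hb : 0 < b) (hbc : b ≤ c) :
    -- `M` has no nontrivial twisted forms
    TwistedForms.HasNoNontrivialTwistedForms (SplitMonoid.splitMonoid K b c) ∧
    -- the automorphism group of `M` over any field extension `L` of `K`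
    (∀ (L : Type u) [Field L] [Algebra K L],
      ∃ Φ : SplitMonoid.matrixGroup L (c / b) ≃*
          TwistedForms.AutOver L (SplitMonoid.splitMonoid K b c),
        ∀ g : SplitMonoid.matrixGroup L (c / b),
          SplitMonoid.pullbackFun (Φ g) (SplitMonoid.coordFun K b c L 0) =
            SplitMonoid.coordFun K b c L 0 ∧
          SplitMonoid.pullbackFun (Φ g) (SplitMonoid.coordFun K b c L 1) =
            SplitMonoid.constFun K b c L (g.1 0 0) * SplitMonoid.coordFun K b c L 1 ∧
          SplitMonoid.pullbackFun (Φ g) (SplitMonoid.coordFun K b c L 2) =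
            SplitMonoid.constFun K b c L (g.1 1 0) *
                SplitMonoid.coordFun K b c L 0 ^ (c - b) * SplitMonoid.coordFun K b c L 1 +
              SplitMonoid.constFun K b c L (g.1 0 0 ^ (c / b + 1)) *
                SplitMonoid.coordFun K b c L 2) ∧
    -- this matrix group is a semidirect product of the additive and the multiplicative group
    (∀ (L : Type u) [Field L] [Algebra K L],
      ∃ Ψ : (Multiplicative L ⋊[SplitMonoid.twistAction L (c / b)] Lˣ) ≃*
          SplitMonoid.matrixGroup L (c / b),
        ∀ (γ : L) (α : Lˣ),
          ((Ψ ⟨Multiplicative.ofAdd γ, α⟩).1 : Matrix (Fin 2) (Fin 2) L) =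
            !![(α : L), 0; γ * α, (α : L) ^ (c / b + 1)]) ∧
    -- the first Galois cohomology set of `Aut(M)` is trivial, at each finite level and in the limit
    (∀ (L : Type u) [Field L] [Algebra K L] [FiniteDimensional K L] [IsGalois K L]
      (x : TwistedForms.H1 (L ≃ₐ[K] L)
        (TwistedForms.AutOver L (SplitMonoid.splitMonoid K b c))),
      x = TwistedForms.H1.base _ _) ∧
    (∀ x : TwistedForms.AbsoluteH1 (SplitMonoid.splitMonoid K b c),
      x = TwistedForms.AbsoluteH1.base _) := by
  have hchar : ∀ (L : Type u) [Field L] [Algebra K L], CharZero L := fun L _ _ =>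
    charZero_of_injective_algebraMap (algebraMap K L).injective
  have hH1 : ∀ (L : Type u) [Field L] [Algebra K L] [FiniteDimensional K L] [IsGalois K L]
      (x : TwistedForms.H1 (L ≃ₐ[K] L)
        (TwistedForms.AutOver L (SplitMonoid.splitMonoid K b c))),
      x = TwistedForms.H1.base _ _ := fun L _ _ _ _ x =>
    have := hchar L
    SplitMonoid.h1_eq_base hb hbc x
  refine ⟨TwistedForms.hasNoNontrivialTwistedForms_of_cocycle _ fun L _ _ _ _ f =>
      have := hchar L
      SplitMonoid.exists_cocycle_eq hb hbc f,
    fun L _ _ => ?_, fun L _ _ => ⟨SplitMonoid.semidirectEquiv L (c / b), fun _ _ => rfl⟩, hH1,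
    SplitMonoid.absoluteH1_eq_base _ fun F x => hH1 F x⟩
  have := hchar L
  refine ⟨SplitMonoid.matrixAutEquiv K L hb hbc, fun g =>
    ⟨SplitMonoid.pullbackFun_matrixAut hbc g 0, SplitMonoid.pullbackFun_matrixAut hbc g 1,
      (SplitMonoid.pullbackFun_matrixAut hbc g 2).trans ?_⟩⟩
  simp [SplitMonoid.matrixAct]
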